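/- Let $n$ be a natural number and let $\mathcal H_1,\mathcal H_2,\mathcal F,\mathcal F_*$ be complex Hilbert spaces. Let $A=(A_1,\dots,A_n)$ and $B=(B_1,\dots,B_n)$ be row contractions on $\mathcal H_1$ and $\mathcal H_2$, i.e. $A:\bigoplus_1^n\mathcal H_1\to\mathcal H_1$ and $B:\bigoplus_1^n\mathcal H_2\to\mathcal H_2$ are contractions. Notation. For a contraction $T$ between Hilbert spaces put $D_T=(I-T^*T)^{1/2}$ and $\mathcal D_T=\overline{\operatorname{ran}}\,D_T$ (so $D_{T^*}=(I-TT^*)^{1/2}$). Let $\Gamma=\bigoplus_{m\ge 0}(\mathbb C^n)^{\otimes m}$ be the full Fock space with vacuum vector $e_\emptyset$ and standard basis $e_1,\dots,e_n$ of $\mathbb C^n$, and let $L_jf=e_j\otimes f$, $R_jf=f\otimes e_j$ be the left and right creation operators. An operator $M\in\mathcal B(\Gamma\otimes\mathcal E,\Gamma\otimes\mathcal E_*)$ is multi-analytic if $M(L_j\otimes I_{\mathcal E})=(L_j\otimes I_{\mathcal E_*})M$ for all $j$; it is purely contractive if moreover $\|M\|\le 1$ and $\|P_{e_\emptyset\otimes\mathcal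 E_*}M(e_\emptyset\otimes\eta)\|<\|\eta\|$ for all $0\ne\eta\in\mathcal E$. It coincides with $M'\in\mathcal B(\Gamma\otimes\mathcal E',\Gamma\otimes\mathcal E_*')$ if there are unitary operators $W:\mathcal E\to\mathcal E'$ and $W_*:\mathcal E_*\to\mathcal E'_*$ with $(I_\Gamma\otimes W_*)M=M'(I_\Gamma\otimes W)$. The characteristic function of a row contraction $T=(T_1,\dots,T_n)$ on $\mathcal H$ is the operator $\Theta_T:\Gamma\otimes\mathcal D_T\to\Gamma\otimes\mathcal D_{T^*}$, $$\Theta_T=\text{SOT-}\lim_{r\to1^-}\Big[-\tilde T+D_{\tilde T^*}(I-r\tilde R\tilde T^*)^{-1}r\tilde R D_{\tilde T}\Big],$$ where $\tilde T=(I_\Gamma\otimes T_1,\dots,I_\Gamma\otimes T_n)$ and $\tilde R=(R_1\otimes I_{\mathcal H},\dots,R_n\otimes I_{\mathcal H})$. Theorem. Let $w:\mathcal D_{A^*}\oplus\mathcal F\to\mathcal D_B\oplus\mathcal F_*$ be a unitary operator, and suppose that $$\Theta=\begin{bmatrix}\Theta_B&0\\0&I_{\Gamma\otimes\mathcal F_*}\end{bmatrix}(I_\Gamma\otimes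 w)\begin{bmatrix}\Theta_A&0\\0&I_{\Gamma\otimes\mathcal F}\end{bmatrix}:\Gamma\otimes(\mathcal D_A\oplus\mathcal F)\to\Gamma\otimes(\mathcal D_{B^*}\oplus\mathcal F_*)$$ is a purely contractive multi-analytic operator. Then $$T=\begin{bmatrix}A&D_{A^*}\,(P_{\mathcal D_{A^*}}w^*|_{\mathcal D_B})\,D_B\\0&B\end{bmatrix}:\Big(\bigoplus_1^n\mathcal H_1\Big)\oplus\Big(\bigoplus_1^n\mathcal H_2\Big)\to\mathcal H_1\oplus\mathcal H_2$$ is a row contraction, and $\Theta$ coincides with $\Theta_T$. -/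

import Mathlib

open Filter Topology ContinuousLinearMap

noncomputable section

namespace RowContraction

universe u v

/-! ### Direct sums, defect operators and defect spaces -/

/-- The Hilbert space direct sum `⊕₁ⁿ H` of `n` copies of `H`. A row operator on `H` is an
element of `B(⊕₁ⁿ H, H)`; it is a row contraction if its norm is at most one. -/
abbrev Copies (n : ℕ) (H : Type u) : Type u := PiLp 2 (fun _ : Fin n => H)

/-- The Hilbert space direct sum `E ⊕ F`. -/
abbrev DSum (E : Type u) (F : Type v) : Type (max u v) := WithLp 2 (E × F)

section Inclusions

variable (E : Type u) (F : Type v) [NormedAddCommGroup E] [InnerProductSpace ℂ E]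
  [NormedAddCommGroup F] [InnerProductSpace ℂ F]

/-- The inclusion `E → E ⊕ F`. -/
def inlL : E →L[ℂ] DSum E F :=
  ((WithLp.prodContinuousLinearEquiv 2 ℂ E F).symm : E × F →L[ℂ] DSum E F) ∘L
    ContinuousLinearMap.inl ℂ E F

/-- The inclusion `F → E ⊕ F`. -/
def inrL : F →L[ℂ] DSum E F :=
  ((WithLp.prodContinuousLinearEquiv 2 ℂ E F).symm : E × F →L[ℂ] DSum E F) ∘L
    ContinuousLinearMap.inr ℂ E F

theorem inlL_apply (x : E) : inlL E F x = WithLp.toLp 2 (x, 0) := rfl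

theorem inrL_apply (y : F) : inrL E F y = WithLp.toLp 2 (0, y) := rfl

end Inclusions

section Defect

variable {H : Type u} {K : Type v} [NormedAddCommGroup H] [InnerProductSpace ℂ H] [CompleteSpace H]
  [NormedAddCommGroup K] [InnerProductSpace ℂ K] [CompleteSpace K]

/-- The defect operator `D_T = (I - T*T)^{1/2}` of a contraction `T`. Thus the defect operator
`D_{T*} = (I - TT*)^{1/2}` is `defectOp (adjoint T)`. -/
def defectOp (T : H →L[ℂ] K) : H →L[ℂ] H := CFC.sqrt (1 - adjoint T ∘L T)

/-- The defect space `𝒟_T`, the closure of the range of `D_T`. -/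
abbrev defectSpace (T : H →L[ℂ] K) : Submodule ℂ H :=
  (LinearMap.range (defectOp T).toLinearMap).topologicalClosure

theorem defectOp_mem (T : H →L[ℂ] K) (x : H) : defectOp T x ∈ defectSpace T :=
  Submodule.le_topologicalClosure _ ⟨x, rfl⟩

/-- `D_T` as an operator from the whole space to the defect space. -/
def defectTo (T : H →L[ℂ] K) : H →L[ℂ] defectSpace T :=
  (defectOp T).codRestrict _ (defectOp_mem T)

/-- `D_T` restricted to the defect space. -/
def defectFrom (T : H →L[ℂ] K) : defectSpace T →L[ℂ] H :=
  defectOp T ∘L (defectSpace T).subtypeL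

theorem defect_nonneg {T : H →L[ℂ] K} (hT : ‖T‖ ≤ 1) : 0 ≤ 1 - adjoint T ∘L T := by
  rw [ContinuousLinearMap.nonneg_iff_isPositive, ContinuousLinearMap.isPositive_def']
  refine ⟨?_, fun x => ?_⟩
  · rw [IsSelfAdjoint, star_sub, star_one, ContinuousLinearMap.star_eq_adjoint,
      ContinuousLinearMap.adjoint_comp, ContinuousLinearMap.adjoint_adjoint]
  · rw [ContinuousLinearMap.reApplyInnerSelf_apply]
    simp only [sub_apply, one_apply_eq_self, inner_sub_left,
      ContinuousLinearMap.comp_apply, ContinuousLinearMap.adjoint_inner_left, map_sub,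
      inner_self_eq_norm_sq]
    have h1 : ‖T x‖ ≤ ‖x‖ := by simpa using T.le_of_opNorm_le hT x
    have := norm_nonneg (T x)
    nlinarith

theorem defectOp_sq {T : H →L[ℂ] K} (hT : ‖T‖ ≤ 1) :
    defectOp T * defectOp T = 1 - adjoint T ∘L T :=
  CFC.sqrt_mul_sqrt_self _ (defect_nonneg hT)

theorem defectOp_nonneg (T : H →L[ℂ] K) : 0 ≤ defectOp T := CFC.sqrt_nonneg _

theorem norm_adjoint_le {T : H →L[ℂ] K} (hT : ‖T‖ ≤ 1) : ‖adjoint T‖ ≤ 1 := by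
  simpa using hT

set_option synthInstance.maxHeartbeats 200000 in
/-- `T D_T = D_{T*} T`. -/
theorem defect_intertwine {T : H →L[ℂ] K} (hT : ‖T‖ ≤ 1) (x : H) :
    T (defectOp T x) = defectOp (adjoint T) (T x) := by
  let M : DSum H K →L[ℂ] DSum H K := inrL H K ∘L T ∘L WithLp.fstL 2 ℂ H K
  let dg (P : H →L[ℂ] H) (Q : K →L[ℂ] K) : DSum H K →L[ℂ] DSum H K :=
    inlL H K ∘L P ∘L WithLp.fstL 2 ℂ H K + inrL H K ∘L Q ∘L WithLp.sndL 2 ℂ H K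
  have dgf : ∀ P Q z, (dg P Q z).fst = P z.fst := by
    intro P Q z; simp [dg, inlL_apply, inrL_apply]
  have dgs : ∀ P Q z, (dg P Q z).snd = Q z.snd := by
    intro P Q z; simp [dg, inlL_apply, inrL_apply]
  have Mf : ∀ z, (M z).fst = 0 := by intro z; simp [M, inrL_apply]
  have Ms : ∀ z, (M z).snd = T z.fst := by intro z; simp [M, inrL_apply]
  have ext' : ∀ a b : DSum H K, a.fst = b.fst → a.snd = b.snd → a = b := by
    intro a b h1 h2
    exact (WithLp.ofLp_injective 2) (Prod.ext h1 h2)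
  have hT' := norm_adjoint_le hT
  have hD := defectOp_sq hT
  have hD' := defectOp_sq hT'
  have pos : 0 ≤ dg (defectOp T) (defectOp (adjoint T)) := by
    have p1 := (ContinuousLinearMap.nonneg_iff_isPositive _).1 (defectOp_nonneg T)
    have p2 := (ContinuousLinearMap.nonneg_iff_isPositive _).1 (defectOp_nonneg (adjoint T))
    rw [ContinuousLinearMap.nonneg_iff_isPositive, ContinuousLinearMap.isPositive_def]
    refine ⟨fun a b => ?_, fun a => ?_⟩
    · simp only [WithLp.prod_inner_apply, ContinuousLinearMap.coe_coe]
      have e1 := p1.isSymmetric a.fst b.fst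
      have e2 := p2.isSymmetric a.snd b.snd
      have := dgf (defectOp T) (defectOp (adjoint T))
      have := dgs (defectOp T) (defectOp (adjoint T))
      simp_all
    · rw [ContinuousLinearMap.reApplyInnerSelf_apply]
      simp only [WithLp.prod_inner_apply, map_add]
      have e1 := p1.re_inner_nonneg_left a.fst
      have e2 := p2.re_inner_nonneg_left a.snd
      have := dgf (defectOp T) (defectOp (adjoint T))
      have := dgs (defectOp T) (defectOp (adjoint T))
      simp_all
      positivity
  have sq : CFC.sqrt (dg (1 - adjoint T ∘L T) (1 - adjoint (adjoint T) ∘L adjoint T)) =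
      dg (defectOp T) (defectOp (adjoint T)) := by
    refine CFC.sqrt_unique ?_ pos
    ext z
    apply ext'
    · rw [mul_apply_eq_comp, dgf, dgf, dgf, ← hD]; rfl
    · rw [mul_apply_eq_comp, dgs, dgs, dgs, ← hD']; rfl
  have comm : Commute (dg (1 - adjoint T ∘L T) (1 - adjoint (adjoint T) ∘L adjoint T)) M := by
    ext z
    apply ext'
    · simp only [mul_apply_eq_comp, dgf, Mf, map_zero]
    · simp only [mul_apply_eq_comp, dgs, dgf, Ms]
      simp
  have comm2 := comm.cfcₙ_nnreal NNReal.sqrt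
  change Commute (CFC.sqrt _) M at comm2
  rw [sq] at comm2
  have := congrArg (fun S : DSum H K →L[ℂ] DSum H K => (S (inlL H K x)).snd) comm2.eq
  simp only [mul_apply_eq_comp, dgs, dgf, Ms] at this
  exact this.symm

/-- A contraction `T` maps `𝒟_T` into `𝒟_{T*}`. -/
theorem mapsTo_defectSpace {T : H →L[ℂ] K} (hT : ‖T‖ ≤ 1) (x : defectSpace T) :
    T x ∈ defectSpace (adjoint T) := by
  have h : Set.MapsTo T (LinearMap.range (defectOp T).toLinearMap : Set H)
      (LinearMap.range (defectOp (adjoint T)).toLinearMap : Set K) := by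
    rintro _ ⟨y, rfl⟩
    exact ⟨T y, (defect_intertwine hT y).symm⟩
  exact h.closure T.continuous x.2

/-- `T` as an operator from `𝒟_T` to `𝒟_{T*}`. -/
def restrictDefect (T : H →L[ℂ] K) (hT : ‖T‖ ≤ 1) :
    defectSpace T →L[ℂ] defectSpace (adjoint T) :=
  (T ∘L (defectSpace T).subtypeL).codRestrict _ (mapsTo_defectSpace hT)

theorem norm_sq_defectOp {T : H →L[ℂ] K} (hT : ‖T‖ ≤ 1) (x : H) :
    ‖defectOp T x‖ ^ 2 = ‖x‖ ^ 2 - ‖T x‖ ^ 2 := by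
  have p1 := (ContinuousLinearMap.nonneg_iff_isPositive _).1 (defectOp_nonneg T)
  have h : inner ℂ (defectOp T x) (defectOp T x) = inner ℂ x x - inner ℂ (T x) (T x) := by
    have := p1.isSymmetric x (defectOp T x)
    simp only [ContinuousLinearMap.coe_coe] at this
    rw [this, ← mul_apply_eq_comp, defectOp_sq hT]
    simp [inner_sub_right, ContinuousLinearMap.adjoint_inner_right]
  have h2 := congrArg RCLike.re h
  simpa only [map_sub, inner_self_eq_norm_sq] using h2

/-- The operator matrix with rows `(T*, D_T)` and `(D_{T*}, -T)` is isometric. -/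
theorem colligation_norm {T : H →L[ℂ] K} (hT : ‖T‖ ≤ 1) (y : K) (k : H) :
    ‖adjoint T y + defectOp T k‖ ^ 2 + ‖-T k + defectOp (adjoint T) y‖ ^ 2 =
      ‖y‖ ^ 2 + ‖k‖ ^ 2 := by
  have h1 := norm_sq_defectOp hT k
  have h2 := norm_sq_defectOp (norm_adjoint_le hT) y
  have p2 := (ContinuousLinearMap.nonneg_iff_isPositive _).1 (defectOp_nonneg (adjoint T))
  have e : inner ℂ (T k) (defectOp (adjoint T) y) = inner ℂ (defectOp T k) (adjoint T y) := by
    have := p2.isSymmetric (T k) y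
    simp only [ContinuousLinearMap.coe_coe] at this
    rw [← this, ← defect_intertwine hT, ContinuousLinearMap.adjoint_inner_right]
  rw [@norm_add_sq ℂ, @norm_add_sq ℂ, h1, h2, norm_neg, inner_neg_left, e,
    ← inner_conj_symm (adjoint T y)]
  simp only [map_neg, RCLike.conj_re]
  ring

end Defect

/-! ### The full Fock space with coefficients -/

/-- `Γ ⊗ E`, where `Γ` is the full Fock space over `ℂⁿ`, expanded along the orthonormal basis
`(e_α)` of `Γ` indexed by the words `α` in `n` letters: `f` stands for `∑_α e_α ⊗ f α`, with
`‖f‖² = ∑_α ‖f α‖²`. The empty word `[]` gives the vacuum vector. -/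
abbrev Fock (n : ℕ) (E : Type u) [NormedAddCommGroup E] : Type u :=
  lp (fun _ : List (Fin n) => E) 2

theorem fock_norm_sq {n : ℕ} {E : Type u} [NormedAddCommGroup E] (f : Fock n E) : HasSum (fun α => ‖f α‖ ^ 2) (‖f‖ ^ 2) := by
  have := lp.hasSum_norm (p := 2) (by norm_num) f
  simpa using this

theorem memlp_two {n : ℕ} {E : Type u} [NormedAddCommGroup E] {f : List (Fin n) → E} (h : Summable fun α => ‖f α‖ ^ 2) : Memℓp f 2 :=
  memℓp_gen (by simpa using h)

section Fock

variable {n : ℕ} {E : Type u} {E' : Type v} [NormedAddCommGroup E] [InnerProductSpace ℂ E]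
  [NormedAddCommGroup E'] [InnerProductSpace ℂ E']

/-- The elementary tensor `e_α ⊗ η`. -/
def elem (α : List (Fin n)) (η : E) : Fock n E := lp.single 2 α η

/-- The operator `I_Γ ⊗ X : Γ ⊗ E → Γ ⊗ E'`. -/
def ampl (n : ℕ) (X : E →L[ℂ] E') : Fock n E →L[ℂ] Fock n E' :=
  lp.mapCLM 2 (fun _ => X) (norm_nonneg X) (fun _ => le_rfl)

@[simp] theorem ampl_apply (X : E →L[ℂ] E') (f : Fock n E) (α : List (Fin n)) :
    ampl n X f α = X (f α) := rfl

theorem ampl_elem (X : E →L[ℂ] E') (α : List (Fin n)) (η : E) :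
    ampl n X (elem α η) = elem α (X η) := by
  ext β
  by_cases h : β = α
  · subst h; simp [elem]
  · simp [elem, h]

/-- The isometry of `Γ ⊗ E` that maps `e_α ⊗ η` to `e_{φ α} ⊗ η`, for an injective map `φ` on
words. -/
def wordMap (φ : List (Fin n) → List (Fin n)) (hφ : Function.Injective φ) :
    Fock n E →L[ℂ] Fock n E :=
  have key (f : Fock n E) :
      HasSum (fun α => ‖Function.extend φ f 0 α‖ ^ 2) (‖f‖ ^ 2) := by
    have h := (hasSum_extend_zero hφ).2 (fock_norm_sq f)
    convert h using 1
    funext α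
    by_cases hα : ∃ β, φ β = α
    · obtain ⟨β, rfl⟩ := hα
      simp [hφ.extend_apply]
    · simp [Function.extend_apply' _ _ _ hα]
  LinearMap.mkContinuous
    { toFun f := ⟨Function.extend φ f 0, memlp_two (key f).summable⟩
      map_add' f g := by
        ext α
        change Function.extend φ (⇑f + ⇑g) 0 α =
          Function.extend φ (⇑f) 0 α + Function.extend φ (⇑g) 0 α
        by_cases hα : ∃ β, φ β = α
        · obtain ⟨β, rfl⟩ := hα
          simp only [hφ.extend_apply, Pi.add_apply]
        · simp [Function.extend_apply' _ _ _ hα]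
      map_smul' c f := by
        ext α
        by_cases hα : ∃ β, φ β = α
        · obtain ⟨β, rfl⟩ := hα
          simp [hφ.extend_apply]
        · simp [Function.extend_apply' _ _ _ hα] }
    1
    (fun f => by
      have h1 := (fock_norm_sq (⟨Function.extend φ f 0, memlp_two (key f).summable⟩ :
        Fock n E)).unique (key f)
      rw [one_mul]
      exact ((pow_left_inj₀ (norm_nonneg _) (norm_nonneg _) two_ne_zero).1 h1).le)

theorem wordMap_apply_self (φ : List (Fin n) → List (Fin n)) (hφ : Function.Injective φ)
    (f : Fock n E) (α : List (Fin n)) : wordMap φ hφ f (φ α) = f α :=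
  hφ.extend_apply _ _ _

theorem wordMap_apply_of_not (φ : List (Fin n) → List (Fin n)) (hφ : Function.Injective φ)
    (f : Fock n E) (α : List (Fin n)) (h : ¬ ∃ β, φ β = α) : wordMap φ hφ f α = 0 :=
  Function.extend_apply' _ _ _ h

theorem norm_wordMap (φ : List (Fin n) → List (Fin n)) (hφ : Function.Injective φ)
    (f : Fock n E) : ‖wordMap φ hφ f‖ = ‖f‖ := by
  have h1 := fock_norm_sq (wordMap φ hφ f)
  rw [← hφ.hasSum_iff] at h1
  · simp only [Function.comp_def, wordMap_apply_self] at h1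
    exact (pow_left_inj₀ (norm_nonneg _) (norm_nonneg _) two_ne_zero).1
      (h1.unique (fock_norm_sq f))
  · intro α hα
    rw [wordMap_apply_of_not _ _ _ _ hα]
    simp

/-- The operator `L_j ⊗ I_E`, where `L_j` is the left creation operator `f ↦ e_j ⊗ f`. -/
def leftCreation (E : Type u) [NormedAddCommGroup E] [InnerProductSpace ℂ E] (j : Fin n) :
    Fock n E →L[ℂ] Fock n E :=
  wordMap (fun α => j :: α) List.cons_injective

/-- The operator `R_j ⊗ I_E`, where `R_j` is the right creation operator `f ↦ f ⊗ e_j`. -/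
def rightCreation (E : Type u) [NormedAddCommGroup E] [InnerProductSpace ℂ E] (j : Fin n) :
    Fock n E →L[ℂ] Fock n E :=
  wordMap (fun α => α ++ [j]) (List.append_left_injective [j])

theorem wordMap_elem (φ : List (Fin n) → List (Fin n)) (hφ : Function.Injective φ)
    (α : List (Fin n)) (η : E) : wordMap φ hφ (elem α η) = elem (φ α) η := by
  ext β
  by_cases hβ : ∃ γ, φ γ = β
  · obtain ⟨γ, rfl⟩ := hβ
    rw [wordMap_apply_self]
    by_cases h : γ = α
    · subst h; simp [elem]
    · have : φ γ ≠ φ α := fun e => h (hφ e)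
      simp [elem, h, this]
  · rw [wordMap_apply_of_not _ _ _ _ hβ]
    have : β ≠ φ α := fun e => hβ ⟨α, e.symm⟩
    simp [elem, this]

theorem leftCreation_elem (j : Fin n) (α : List (Fin n)) (η : E) :
    leftCreation E j (elem α η) = elem (j :: α) η := wordMap_elem _ _ _ _

theorem rightCreation_elem (j : Fin n) (α : List (Fin n)) (η : E) :
    rightCreation E j (elem α η) = elem (α ++ [j]) η := wordMap_elem _ _ _ _

/-- The row operator `R̃ = (R_1 ⊗ I, …, R_n ⊗ I) : Γ ⊗ (⊕₁ⁿ E) → Γ ⊗ E`, where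
`Γ ⊗ (⊕₁ⁿ E)` is identified with `⊕₁ⁿ (Γ ⊗ E)`. -/
def rowR (n : ℕ) (E : Type u) [NormedAddCommGroup E] [InnerProductSpace ℂ E] :
    Fock n (Copies n E) →L[ℂ] Fock n E :=
  ∑ j : Fin n, rightCreation E j ∘L ampl n (PiLp.proj 2 (fun _ : Fin n => E) j)

theorem rightCreation_nil (j : Fin n) (f : Fock n E) : rightCreation E j f [] = 0 :=
  wordMap_apply_of_not _ _ _ _ (by simp)

theorem rightCreation_append (i j : Fin n) (f : Fock n E) (α : List (Fin n)) :
    rightCreation E j f (α ++ [i]) = if i = j then f α else 0 := by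
  by_cases h : i = j
  · subst h
    rw [if_pos rfl]
    exact wordMap_apply_self _ _ f α
  · rw [if_neg h]
    refine wordMap_apply_of_not _ _ _ _ ?_
    rintro ⟨β, hβ⟩
    have := List.append_inj' hβ rfl
    simp at this
    exact h this.2.symm

theorem rowR_apply (g : Fock n (Copies n E)) (α : List (Fin n)) :
    rowR n E g α = ∑ j, rightCreation E j (ampl n (PiLp.proj 2 (fun _ : Fin n => E) j) g) α := by
  simp only [rowR, sum_apply, ContinuousLinearMap.comp_apply]
  rw [lp.coeFn_sum, Finset.sum_apply]

theorem rowR_nil (g : Fock n (Copies n E)) : rowR n E g [] = 0 := by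
  rw [rowR_apply]
  simp [rightCreation_nil]

theorem rowR_append (g : Fock n (Copies n E)) (α : List (Fin n)) (i : Fin n) :
    rowR n E g (α ++ [i]) = g α i := by
  rw [rowR_apply]
  simp [rightCreation_append]

theorem norm_rowR_apply (g : Fock n (Copies n E)) : ‖rowR n E g‖ = ‖g‖ := by
  let φ : List (Fin n) × Fin n → List (Fin n) := fun p => p.1 ++ [p.2]
  have hφ : Function.Injective φ := by
    rintro ⟨a, i⟩ ⟨b, j⟩ h
    have := List.append_inj' h rfl
    simp at this
    exact Prod.ext this.1 this.2
  have h1 := fock_norm_sq (rowR n E g)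
  rw [← hφ.hasSum_iff] at h1
  · have h3 : HasSum (fun α => ‖g α‖ ^ 2) (‖rowR n E g‖ ^ 2) := by
      refine h1.prod_fiberwise fun α => ?_
      have : ‖g α‖ ^ 2 = ∑ i, ‖g α i‖ ^ 2 := PiLp.norm_sq_eq_of_L2 _ _
      rw [this]
      simp only [Function.comp_def, φ, rowR_append]
      exact hasSum_fintype _
    exact (pow_left_inj₀ (norm_nonneg _) (norm_nonneg _) two_ne_zero).1
      (h3.unique (fock_norm_sq g))
  · intro α hα
    rcases List.eq_nil_or_concat α with rfl | ⟨β, i, rfl⟩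
    · simp [rowR_nil]
    · exact absurd ⟨(β, i), by simp [φ]⟩ hα

end Fock

/-! ### The characteristic function of a row contraction -/

section CharFn

variable {n : ℕ} {H : Type u} [NormedAddCommGroup H] [InnerProductSpace ℂ H] [CompleteSpace H]

/-- The operator `R̃ T̃* = ∑_j R_j ⊗ T_j*` on `Γ ⊗ H`, for a row operator `T = (T_1, …, T_n)`. -/
def rowRAdj (T : Copies n H →L[ℂ] H) : Fock n H →L[ℂ] Fock n H :=
  rowR n H ∘L ampl n (adjoint T)

/-- The operator `Θ_T(rR) = -T̃ + D_{T̃*} (I - r R̃ T̃*)⁻¹ r R̃ D_{T̃}` from `Γ ⊗ 𝒟_T` to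
`Γ ⊗ 𝒟_{T*}`, where `T̃ = I_Γ ⊗ T`; the operator that is inverted is invertible for
`0 ≤ r < 1`. -/
def charFnAt (T : Copies n H →L[ℂ] H) (hT : ‖T‖ ≤ 1) (r : ℝ) :
    Fock n (defectSpace T) →L[ℂ] Fock n (defectSpace (adjoint T)) :=
  -ampl n (restrictDefect T hT) +
    ampl n (defectTo (adjoint T)) ∘L Ring.inverse (1 - (r : ℂ) • rowRAdj T) ∘L
      ((r : ℂ) • rowR n H) ∘L ampl n (defectFrom T)

theorem norm_ampl_le {E E' : Type*} [NormedAddCommGroup E] [InnerProductSpace ℂ E]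
    [NormedAddCommGroup E'] [InnerProductSpace ℂ E'] (X : E →L[ℂ] E') : ‖ampl n X‖ ≤ ‖X‖ :=
  lp.norm_mapCLM_le _ _ _ _

theorem norm_rowRAdj_le {T : Copies n H →L[ℂ] H} (hT : ‖T‖ ≤ 1) : ‖rowRAdj T‖ ≤ 1 := by
  refine ContinuousLinearMap.opNorm_le_bound _ zero_le_one fun f => ?_
  rw [rowRAdj, ContinuousLinearMap.comp_apply, norm_rowR_apply]
  exact (ampl n (adjoint T)).le_of_opNorm_le ((norm_ampl_le _).trans (norm_adjoint_le hT)) f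

theorem isUnit_one_sub {T : Copies n H →L[ℂ] H} (hT : ‖T‖ ≤ 1) {r : ℝ} (h0 : 0 ≤ r) (h1 : r < 1) :
    IsUnit (1 - (r : ℂ) • rowRAdj T) := by
  refine isUnit_one_sub_of_norm_lt_one ?_
  rw [norm_smul, Complex.norm_real, Real.norm_of_nonneg h0]
  have := norm_rowRAdj_le hT
  nlinarith [norm_nonneg (rowRAdj T)]

/-- The vector `(I - r R̃ T̃*)⁻¹ r R̃ D_{T̃} f`. -/
def stateAt (T : Copies n H →L[ℂ] H) (r : ℝ) (f : Fock n (defectSpace T)) : Fock n H :=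
  Ring.inverse (1 - (r : ℂ) • rowRAdj T) (((r : ℂ) • rowR n H) (ampl n (defectFrom T) f))

theorem stateAt_eq {T : Copies n H →L[ℂ] H} (hT : ‖T‖ ≤ 1) {r : ℝ} (h0 : 0 ≤ r) (h1 : r < 1)
    (f : Fock n (defectSpace T)) :
    stateAt T r f = (r : ℂ) • rowR n H
      (ampl n (adjoint T) (stateAt T r f) + ampl n (defectFrom T) f) := by
  have h := Ring.mul_inverse_cancel _ (isUnit_one_sub hT h0 h1)
  have h2 := congrArg (fun S : Fock n H →L[ℂ] Fock n H =>
    S (((r : ℂ) • rowR n H) (ampl n (defectFrom T) f))) h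
  simp only [mul_apply_eq_comp, one_apply_eq_self] at h2
  change (1 - (r : ℂ) • rowRAdj T) (stateAt T r f) = _ at h2
  rw [map_add, smul_add]
  simp only [sub_apply, one_apply_eq_self, smul_apply, rowRAdj,
    ContinuousLinearMap.comp_apply] at h2
  rw [← h2]
  abel

theorem stateAt_nil {T : Copies n H →L[ℂ] H} (hT : ‖T‖ ≤ 1) {r : ℝ} (h0 : 0 ≤ r) (h1 : r < 1)
    (f : Fock n (defectSpace T)) : stateAt T r f [] = 0 := by
  rw [stateAt_eq hT h0 h1, lp.coeFn_smul, Pi.smul_apply, rowR_nil, smul_zero]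

theorem stateAt_append {T : Copies n H →L[ℂ] H} (hT : ‖T‖ ≤ 1) {r : ℝ} (h0 : 0 ≤ r) (h1 : r < 1)
    (f : Fock n (defectSpace T)) (α : List (Fin n)) (i : Fin n) :
    stateAt T r f (α ++ [i]) =
      (r : ℂ) • (adjoint T (stateAt T r f α) + defectFrom T (f α)) i := by
  conv_lhs => rw [stateAt_eq hT h0 h1, lp.coeFn_smul, Pi.smul_apply, rowR_append]
  rfl

theorem charFnAt_apply (T : Copies n H →L[ℂ] H) (hT : ‖T‖ ≤ 1) (r : ℝ)
    (f : Fock n (defectSpace T)) (α : List (Fin n)) :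
    charFnAt T hT r f α =
      -restrictDefect T hT (f α) + defectTo (adjoint T) (stateAt T r f α) := rfl

theorem norm_charFnAt_le (T : Copies n H →L[ℂ] H) (hT : ‖T‖ ≤ 1) {r : ℝ} (h0 : 0 ≤ r)
    (h1 : r < 1) : ‖charFnAt T hT r‖ ≤ 1 := by
  refine ContinuousLinearMap.opNorm_le_bound _ zero_le_one fun f => ?_
  rw [one_mul]
  set x := stateAt T r f with hx
  set g := ampl n (adjoint T) x + ampl n (defectFrom T) f with hg
  have e1 : ‖x‖ = r * ‖g‖ := by
    rw [hx, stateAt_eq hT h0 h1, norm_smul, Complex.norm_real, Real.norm_of_nonneg h0,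
      norm_rowR_apply]
  have e2 : ‖g‖ ^ 2 + ‖charFnAt T hT r f‖ ^ 2 = ‖x‖ ^ 2 + ‖f‖ ^ 2 := by
    refine ((fock_norm_sq g).add (fock_norm_sq (charFnAt T hT r f))).unique ?_
    convert (fock_norm_sq x).add (fock_norm_sq f) using 1
    funext α
    exact colligation_norm hT (x α) (f α : Copies n H)
  have e3 : ‖x‖ ^ 2 ≤ ‖g‖ ^ 2 := by
    rw [e1, mul_pow]
    have : r ^ 2 ≤ 1 := by nlinarith
    nlinarith [sq_nonneg ‖g‖]
  exact (pow_le_pow_iff_left₀ (norm_nonneg _) (norm_nonneg _) two_ne_zero).1 (by linarith)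

/-- The coefficients of `Θ_T(rR) (e_β ⊗ η)` depend on `r` as `r ^ (|α| - |β|)`. -/
theorem charFnAt_elem_apply (T : Copies n H →L[ℂ] H) (hT : ‖T‖ ≤ 1) (β : List (Fin n))
    (η : defectSpace T) : ∃ c : List (Fin n) → defectSpace (adjoint T),
      ∀ r : ℝ, 0 < r → r < 1 → ∀ α,
        (r : ℂ) ^ β.length • charFnAt T hT r (elem β η) α = (r : ℂ) ^ α.length • c α := by
  have key : ∀ α : List (Fin n), ∃ z : H, ∀ r : ℝ, 0 < r → r < 1 →
      (r : ℂ) ^ β.length • stateAt T r (elem β η) α = (r : ℂ) ^ α.length • z := by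
    intro α
    induction α using List.reverseRecOn with
    | nil => exact ⟨0, fun r h0 h1 => by rw [stateAt_nil hT h0.le h1]; simp⟩
    | append_singleton α i ih =>
      obtain ⟨z, hz⟩ := ih
      refine ⟨(adjoint T z + defectFrom T ((elem β η : Fock n (defectSpace T)) α)) i,
        fun r h0 h1 => ?_⟩
      have e1 : (r : ℂ) ^ β.length • adjoint T (stateAt T r (elem β η) α) =
          (r : ℂ) ^ α.length • adjoint T z := by rw [← map_smul, hz r h0 h1, map_smul]
      have e2 : (r : ℂ) ^ β.length • defectFrom T ((elem β η : Fock n (defectSpace T)) α) =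
          (r : ℂ) ^ α.length • defectFrom T ((elem β η : Fock n (defectSpace T)) α) := by
        by_cases h : α = β
        · rw [h]
        · simp [elem, h]
      have e3 := congrArg (fun v : Copies n H => v i) (congrArg₂ (· + ·) e1 e2)
      simp only [← smul_add, PiLp.smul_apply] at e3
      rw [stateAt_append hT h0.le h1, smul_comm, e3, smul_smul, List.length_append, pow_add,
        List.length_singleton, pow_one, mul_comm]
  choose z hz using key
  refine ⟨fun α => -restrictDefect T hT ((elem β η : Fock n (defectSpace T)) α) +
    defectTo (adjoint T) (z α), fun r h0 h1 α => ?_⟩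
  rw [charFnAt_apply, smul_add, smul_add]
  congr 1
  · by_cases h : α = β
    · rw [h]
    · simp [elem, h]
  · rw [← map_smul, hz α r h0 h1, map_smul]

/-- Convergence of `r ^ |α| u α` to `u` in norm as `r → 1`. -/
theorem tendsto_dilate {E : Type*} [NormedAddCommGroup E] [InnerProductSpace ℂ E] (u : Fock n E)
    (F : ℝ → Fock n E) (hF : ∀ r : ℝ, 0 < r → r < 1 → ∀ α, F r α = (r : ℂ) ^ α.length • u α) :
    Tendsto F (𝓝[<] 1) (𝓝 u) := by
  rw [tendsto_iff_norm_sub_tendsto_zero]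
  have hev : ∀ᶠ r : ℝ in 𝓝[<] 1, 0 < r ∧ r < 1 :=
    Ioo_mem_nhdsLT (zero_lt_one)
  have h2 : Tendsto (fun r => ‖F r - u‖ ^ 2) (𝓝[<] 1) (𝓝 0) := by
    have h3 : (fun r => ‖F r - u‖ ^ 2) = fun r => ∑' α, ‖(F r - u) α‖ ^ 2 := by
      funext r; exact (fock_norm_sq _).tsum_eq.symm
    rw [h3, show (0 : ℝ) = ∑' _ : List (Fin n), (0 : ℝ) by simp]
    refine tendsto_tsum_of_dominated_convergence (bound := fun α => ‖u α‖ ^ 2)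
      (fock_norm_sq u).summable (fun α => ?_) ?_
    · have : Tendsto (fun r : ℝ => ‖((r : ℂ) ^ α.length - 1) • u α‖ ^ 2) (𝓝[<] 1) (𝓝 0) := by
        have : Continuous (fun r : ℝ => ‖((r : ℂ) ^ α.length - 1) • u α‖ ^ 2) := by fun_prop
        have := (this.tendsto 1).mono_left (nhdsWithin_le_nhds (s := Set.Iio 1))
        simpa using this
      refine this.congr' ?_
      filter_upwards [hev] with r hr
      rw [lp.coeFn_sub, Pi.sub_apply, hF r hr.1 hr.2, sub_smul, one_smul]
    · filter_upwards [hev] with r hr α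
      rw [lp.coeFn_sub, Pi.sub_apply, hF r hr.1 hr.2]
      have : (r : ℂ) ^ α.length • u α - u α = ((r ^ α.length - 1 : ℝ) : ℂ) • u α := by
        push_cast; rw [sub_smul, one_smul]
      rw [this, norm_smul, Complex.norm_real, mul_pow, Real.norm_of_nonneg (by positivity),
        Real.norm_eq_abs, sq_abs]
      have p0 : 0 ≤ r ^ α.length := pow_nonneg hr.1.le _
      have p1 : r ^ α.length ≤ 1 := pow_le_one₀ hr.1.le hr.2.le
      have : (r ^ α.length - 1) ^ 2 ≤ 1 := by nlinarith
      nlinarith [sq_nonneg ‖u α‖]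
  have h4 := h2.sqrt
  simpa using h4

theorem charFnAt_elem_tendsto (T : Copies n H →L[ℂ] H) (hT : ‖T‖ ≤ 1) (β : List (Fin n))
    (η : defectSpace T) :
    ∃ y, Tendsto (fun r => charFnAt T hT r (elem β η)) (𝓝[<] 1) (𝓝 y) := by
  obtain ⟨c, hc⟩ := charFnAt_elem_apply T hT β η
  have hev : ∀ᶠ r : ℝ in 𝓝[<] 1, 0 < r ∧ r < 1 := Ioo_mem_nhdsLT zero_lt_one
  let G : ℝ → Fock n (defectSpace (adjoint T)) :=
    fun r => (r : ℂ) ^ β.length • charFnAt T hT r (elem β η)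
  have hG : ∀ r : ℝ, 0 < r → r < 1 → ∀ α, G r α = (r : ℂ) ^ α.length • c α := by
    intro r h0 h1 α
    rw [← hc r h0 h1 α]
    rfl
  have hmem : Memℓp c 2 := by
    let s : ℕ → ℝ := fun k => 1 - 1 / ((k : ℝ) + 2)
    have hs0 : ∀ k, 0 < s k := by
      intro k
      have : (1 : ℝ) / ((k : ℝ) + 2) < 1 := by 
        rw [div_lt_one (by positivity)]
        linarith [k.cast_nonneg (α := ℝ)]
      simp only [s]; linarith
    have hs1 : ∀ k, s k < 1 := by
      intro k
      have : (0 : ℝ) < 1 / ((k : ℝ) + 2) := by positivity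
      simp only [s]; linarith
    have hs : Tendsto s atTop (𝓝 1) := by
      have h1 := (tendsto_one_div_add_atTop_nhds_zero_nat (𝕜 := ℝ)).comp (tendsto_add_atTop_nat 1)
      have h2 : Tendsto (fun k : ℕ => 1 - 1 / (((k + 1 : ℕ) : ℝ) + 1)) atTop (𝓝 (1 - 0)) :=
        tendsto_const_nhds.sub h1
      rw [sub_zero] at h2
      refine h2.congr fun k => ?_
      simp only [s]; push_cast; ring_nf
    refine lp.memℓp_of_tendsto (l := atTop) (F := fun k => G (s k)) ?_ ?_
    · refine (isBounded_iff_forall_norm_le).2 ⟨‖(elem β η : Fock n (defectSpace T))‖, ?_⟩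
      rintro _ ⟨k, rfl⟩
      simp only [G, norm_smul, norm_pow, Complex.norm_real, Real.norm_of_nonneg (hs0 k).le]
      have a1 := (charFnAt T hT (s k)).le_of_opNorm_le
        (norm_charFnAt_le T hT (hs0 k).le (hs1 k)) (elem β η)
      have a2 : s k ^ β.length ≤ 1 := pow_le_one₀ (hs0 k).le (hs1 k).le
      have a3 : 0 ≤ s k ^ β.length := pow_nonneg (hs0 k).le _
      rw [one_mul] at a1
      nlinarith [norm_nonneg (charFnAt T hT (s k) (elem β η))]
    · refine tendsto_pi_nhds.2 fun α => ?_
      have : Continuous (fun r : ℝ => (r : ℂ) ^ α.length • c α) := by fun_prop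
      have := (this.tendsto 1).comp hs
      simp only [Complex.ofReal_one, one_pow, one_smul] at this
      refine this.congr fun k => ?_
      exact (hG (s k) (hs0 k) (hs1 k) α).symm
  have h1 := tendsto_dilate (⟨c, hmem⟩ : Fock n _) G hG
  refine ⟨⟨c, hmem⟩, ?_⟩
  have h2 : Tendsto (fun r : ℝ => ((r : ℂ) ^ β.length)⁻¹) (𝓝[<] 1) (𝓝 1) := by
    have : ContinuousAt (fun r : ℝ => ((r : ℂ) ^ β.length)⁻¹) 1 := by
      refine ContinuousAt.inv₀ (by fun_prop) (by simp)
    have := this.tendsto.mono_left (nhdsWithin_le_nhds (s := Set.Iio 1))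
    simpa using this
  have h3 := h2.smul h1
  rw [one_smul] at h3
  refine h3.congr' ?_
  filter_upwards [hev] with r hr
  have : (r : ℂ) ^ β.length ≠ 0 := pow_ne_zero _ (by exact_mod_cast hr.1.ne')
  simp only [G]
  rw [inv_smul_smul₀ this]

theorem charFnAt_tendsto (T : Copies n H →L[ℂ] H) (hT : ‖T‖ ≤ 1) (f : Fock n (defectSpace T)) :
    ∃ y, Tendsto (fun r => charFnAt T hT r f) (𝓝[<] 1) (𝓝 y) := by
  have hev : ∀ᶠ r : ℝ in 𝓝[<] 1, 0 < r ∧ r < 1 := Ioo_mem_nhdsLT zero_lt_one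
  have hfin : ∀ s : Finset (List (Fin n)),
      ∃ y, Tendsto (fun r => charFnAt T hT r (∑ α ∈ s, elem α (f α))) (𝓝[<] 1) (𝓝 y) := by
    intro s
    choose y hy using fun α => charFnAt_elem_tendsto T hT α (f α)
    refine ⟨∑ α ∈ s, y α, ?_⟩
    simp only [map_sum]
    exact tendsto_finsetSum _ fun α _ => hy α
  have hsum : HasSum (fun α => (elem α (f α) : Fock n (defectSpace T))) f :=
    lp.hasSum_single (by norm_num) f
  refine cauchy_map_iff_exists_tendsto.1 ?_
  rw [Metric.cauchy_iff]
  refine ⟨inferInstance, fun ε hε => ?_⟩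
  obtain ⟨s, hs⟩ := (Metric.tendsto_nhds.1 hsum (ε / 4) (by positivity)).exists
  obtain ⟨y, hy⟩ := hfin s
  have hy' := Metric.tendsto_nhds.1 hy (ε / 4) (by positivity)
  refine ⟨_, image_mem_map (hev.and hy'), ?_⟩
  have main : ∀ r : ℝ, ((0 < r ∧ r < 1) ∧
      dist (charFnAt T hT r (∑ α ∈ s, elem α (f α))) y < ε / 4) →
      dist (charFnAt T hT r f) y < ε / 2 := by
    rintro r ⟨⟨h0, h1⟩, h2⟩
    have h3 : dist (charFnAt T hT r f) (charFnAt T hT r (∑ α ∈ s, elem α (f α))) < ε / 4 := by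
      rw [dist_eq_norm, ← map_sub]
      refine lt_of_le_of_lt ((charFnAt T hT r).le_of_opNorm_le
        (norm_charFnAt_le T hT h0.le h1) _) ?_
      rw [one_mul, ← dist_eq_norm, dist_comm]
      exact hs
    have := dist_triangle (charFnAt T hT r f) (charFnAt T hT r (∑ α ∈ s, elem α (f α))) y
    linarith
  rintro _ ⟨r, hr, rfl⟩ _ ⟨r', hr', rfl⟩
  have a := main r hr
  have b := main r' hr'
  have := dist_triangle_right (charFnAt T hT r f) (charFnAt T hT r' f) y
  linarith

theorem exists_charFn (T : Copies n H →L[ℂ] H) (hT : ‖T‖ ≤ 1) :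
    ∃ Θ : Fock n (defectSpace T) →L[ℂ] Fock n (defectSpace (adjoint T)),
      ∀ f, Tendsto (fun r => charFnAt T hT r f) (𝓝[<] 1) (𝓝 (Θ f)) := by
  choose y hy using charFnAt_tendsto T hT
  exact ⟨continuousLinearMapOfTendsto (charFnAt T hT) (tendsto_pi_nhds.2 hy), hy⟩

/-- The characteristic function `Θ_T : Γ ⊗ 𝒟_T → Γ ⊗ 𝒟_{T*}` of the row contraction `T`, the limit
of `Θ_T(rR)` in the strong operator topology as `r → 1⁻`. -/
def charFn (T : Copies n H →L[ℂ] H) (hT : ‖T‖ ≤ 1) :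
    Fock n (defectSpace T) →L[ℂ] Fock n (defectSpace (adjoint T)) :=
  (exists_charFn T hT).choose

theorem charFn_tendsto (T : Copies n H →L[ℂ] H) (hT : ‖T‖ ≤ 1) (f : Fock n (defectSpace T)) :
    Tendsto (fun r => charFnAt T hT r f) (𝓝[<] 1) (𝓝 (charFn T hT f)) :=
  (exists_charFn T hT).choose_spec f

end CharFn

/-! ### Multi-analytic operators -/

section MultiAnalytic

/-- `M : Γ ⊗ E → Γ ⊗ E'` is multi-analytic: `M (L_j ⊗ I) = (L_j ⊗ I) M` for all `j`. -/
def IsMultiAnalytic {n : ℕ} {E : Type u} {E' : Type v} [NormedAddCommGroup E]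
    [InnerProductSpace ℂ E] [NormedAddCommGroup E'] [InnerProductSpace ℂ E']
    (M : Fock n E →L[ℂ] Fock n E') : Prop :=
  ∀ j : Fin n, M ∘L leftCreation E j = leftCreation E' j ∘L M

/-- `M : Γ ⊗ E → Γ ⊗ E'` is purely contractive: it is a contraction and
`‖P_{e_∅ ⊗ E'} M (e_∅ ⊗ η)‖ < ‖η‖` for all `η ≠ 0`. The projection of `g` onto `e_∅ ⊗ E'` is
`e_∅ ⊗ g []`, of norm `‖g []‖`. -/
def IsPurelyContractive {n : ℕ} {E : Type u} {E' : Type v} [NormedAddCommGroup E]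
    [InnerProductSpace ℂ E] [NormedAddCommGroup E'] [InnerProductSpace ℂ E']
    (M : Fock n E →L[ℂ] Fock n E') : Prop :=
  ‖M‖ ≤ 1 ∧ ∀ η : E, η ≠ 0 → ‖M (elem [] η) []‖ < ‖η‖

/-- `M` and `M'` coincide: `(I_Γ ⊗ W_*) M = M' (I_Γ ⊗ W)` for some unitary operators `W` and `W_*`
between the coefficient spaces. -/
def Coincides {n : ℕ} {E E' G G' : Type*}
    [NormedAddCommGroup E] [InnerProductSpace ℂ E] [NormedAddCommGroup E'] [InnerProductSpace ℂ E']
    [NormedAddCommGroup G] [InnerProductSpace ℂ G] [NormedAddCommGroup G'] [InnerProductSpace ℂ G']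
    (M : Fock n E →L[ℂ] Fock n E') (M' : Fock n G →L[ℂ] Fock n G') : Prop :=
  ∃ (W : E ≃ₗᵢ[ℂ] G) (Ws : E' ≃ₗᵢ[ℂ] G'),
    ampl n (Ws.toContinuousLinearEquiv : E' →L[ℂ] G') ∘L M =
      M' ∘L ampl n (W.toContinuousLinearEquiv : E →L[ℂ] G)

/-- The block diagonal operator `diag(M, I) : Γ ⊗ (E ⊕ G) → Γ ⊗ (E' ⊕ G)`, where `Γ ⊗ (E ⊕ G)` is
identified with `(Γ ⊗ E) ⊕ (Γ ⊗ G)`. -/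
def diagId {n : ℕ} {E E' : Type u} (G : Type v)
    [NormedAddCommGroup E] [InnerProductSpace ℂ E] [NormedAddCommGroup E'] [InnerProductSpace ℂ E']
    [NormedAddCommGroup G] [InnerProductSpace ℂ G] (M : Fock n E →L[ℂ] Fock n E') :
    Fock n (DSum E G) →L[ℂ] Fock n (DSum E' G) :=
  ampl n (inlL E' G) ∘L M ∘L ampl n (WithLp.fstL 2 ℂ E G) +
    ampl n (inrL E' G) ∘L ampl n (WithLp.sndL 2 ℂ E G)

/-- The corner `P_E w*|_{E'} : E' → E` of the adjoint of a unitary operator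
`w : E ⊕ G → E' ⊕ G'`. -/
def adjointCorner {E E' G G' : Type*}
    [NormedAddCommGroup E] [InnerProductSpace ℂ E] [NormedAddCommGroup E'] [InnerProductSpace ℂ E']
    [NormedAddCommGroup G] [InnerProductSpace ℂ G] [NormedAddCommGroup G'] [InnerProductSpace ℂ G']
    (w : DSum E G ≃ₗᵢ[ℂ] DSum E' G') : E' →L[ℂ] E :=
  WithLp.fstL 2 ℂ E G ∘L
    (w.symm.toContinuousLinearEquiv : DSum E' G' →L[ℂ] DSum E G) ∘L inlL E' G'

end MultiAnalytic

/-! ### Upper triangular row operators -/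

section Triangular

variable {n : ℕ} {H₁ : Type u} {H₂ : Type v}
  [NormedAddCommGroup H₁] [InnerProductSpace ℂ H₁] [CompleteSpace H₁]
  [NormedAddCommGroup H₂] [InnerProductSpace ℂ H₂] [CompleteSpace H₂]

/-- The projection `⊕₁ⁿ (H₁ ⊕ H₂) → ⊕₁ⁿ H₁`, `(hⱼ ⊕ kⱼ)ⱼ ↦ (hⱼ)ⱼ`. -/
def copiesFst (n : ℕ) (H₁ : Type u) (H₂ : Type v)
    [NormedAddCommGroup H₁] [InnerProductSpace ℂ H₁]
    [NormedAddCommGroup H₂] [InnerProductSpace ℂ H₂] :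
    Copies n (DSum H₁ H₂) →L[ℂ] Copies n H₁ :=
  ((PiLp.continuousLinearEquiv 2 ℂ (fun _ : Fin n => H₁)).symm :
      (Fin n → H₁) →L[ℂ] Copies n H₁) ∘L
    ContinuousLinearMap.pi fun j => WithLp.fstL 2 ℂ H₁ H₂ ∘L
      PiLp.proj 2 (fun _ : Fin n => DSum H₁ H₂) j

/-- The projection `⊕₁ⁿ (H₁ ⊕ H₂) → ⊕₁ⁿ H₂`, `(hⱼ ⊕ kⱼ)ⱼ ↦ (kⱼ)ⱼ`. -/
def copiesSnd (n : ℕ) (H₁ : Type u) (H₂ : Type v)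
    [NormedAddCommGroup H₁] [InnerProductSpace ℂ H₁]
    [NormedAddCommGroup H₂] [InnerProductSpace ℂ H₂] :
    Copies n (DSum H₁ H₂) →L[ℂ] Copies n H₂ :=
  ((PiLp.continuousLinearEquiv 2 ℂ (fun _ : Fin n => H₂)).symm :
      (Fin n → H₂) →L[ℂ] Copies n H₂) ∘L
    ContinuousLinearMap.pi fun j => WithLp.sndL 2 ℂ H₁ H₂ ∘L
      PiLp.proj 2 (fun _ : Fin n => DSum H₁ H₂) j

/-- The row operator on `H₁ ⊕ H₂` with matrix `[A X; 0 B]` with respect to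
`⊕₁ⁿ (H₁ ⊕ H₂) = (⊕₁ⁿ H₁) ⊕ (⊕₁ⁿ H₂)`. -/
def upperTriangular (A : Copies n H₁ →L[ℂ] H₁) (X : Copies n H₂ →L[ℂ] H₁)
    (B : Copies n H₂ →L[ℂ] H₂) : Copies n (DSum H₁ H₂) →L[ℂ] DSum H₁ H₂ :=
  inlL H₁ H₂ ∘L (A ∘L copiesFst n H₁ H₂ + X ∘L copiesSnd n H₁ H₂) +
    inrL H₁ H₂ ∘L B ∘L copiesSnd n H₁ H₂

end Triangular

end RowContraction

end

open RowContraction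

noncomputable section

namespace RowContraction

universe u v

/-! ### The characteristic function as a transfer function -/

section Transfer

variable {n : ℕ} {H : Type*} [NormedAddCommGroup H] [InnerProductSpace ℂ H] [CompleteSpace H]

/-! The characteristic function is the transfer function of a linear system indexed by words. With
`x [] = 0` and `x (α i)` the `i`-th entry of `T* x(α) + D_T f(α)`, the coefficient of `Θ_T f` at `α`
is `-T f(α) + D_{T*} x(α)` (`charFn_apply`). The matrix `(T*, D_T; D_{T*}, -T)` of this system is
unitary.

Feeding the output of the system of `A` through `w` into the system of `B`, with `F` and `F_*` as
bypass channels, gives a cascade. It is again unitary (`isUnitaryColligation_cascade`), its transfer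
function is the product `Θ` (`exists_cascade_stateSeq`), and its state operator sends `(x, y)` to
`(A* x, B* y + D_B P w (D_{A*} x ⊕ 0))`. This is the adjoint of the triangular `T` of the theorem,
whose corner is chosen for that reason.

It remains to recognise a unitary colligation `(T*, G; C, D)` as the canonical one of `T`
(`exists_unitary_of_colligation`). Unitarity gives `‖G* k‖ = ‖D_T k‖` and `‖C h‖ = ‖D_{T*} h‖`. Pure
contractivity of `Θ` says that `D` strictly decreases norms, which forces `G*` and `C` to have dense
range. Hence `G* k ↦ D_T k` and `C h ↦ D_{T*} h` extend to unitaries between the external spaces and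
the defect spaces, and these implement the coincidence. -/

/-- The state sequence of the row contraction `T` driven by the input `f`. -/
def IsStateSeq (T : Copies n H →L[ℂ] H) (f : Fock n (defectSpace T)) (x : List (Fin n) → H) :
    Prop :=
  x [] = 0 ∧ ∀ α i, x (α ++ [i]) = (adjoint T (x α) + defectFrom T (f α)) i

theorem exists_isStateSeq (T : Copies n H →L[ℂ] H) (f : Fock n (defectSpace T)) :
    ∃ x, IsStateSeq T f x := by
  -- The state equation removes the last letter of a word and `List.rec` the first, so the recursion
  -- runs on reversed words.
  let y : List (Fin n) → H := fun α =>
    List.rec 0 (fun i β z => (adjoint T z + defectFrom T (f β.reverse)) i) α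
  refine ⟨fun α => y α.reverse, rfl, fun α i => ?_⟩
  have e : (α ++ [i]).reverse = i :: α.reverse := by simp
  change y (α ++ [i]).reverse = _
  rw [e]
  change (adjoint T (y α.reverse) + defectFrom T (f α.reverse.reverse)) i = _
  rw [List.reverse_reverse]

/-- Each coefficient comes from finitely many steps of a recursion that is continuous in `r`, so
induction on the word suffices. Only coefficientwise convergence is available in general: the limit
`x` need not be square summable. -/
theorem stateAt_tendsto {T : Copies n H →L[ℂ] H} (hT : ‖T‖ ≤ 1) {f : Fock n (defectSpace T)}
    {x : List (Fin n) → H} (hx : IsStateSeq T f x) (α : List (Fin n)) :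
    Tendsto (fun r => stateAt T r f α) (𝓝[<] 1) (𝓝 (x α)) := by
  have hev : ∀ᶠ r : ℝ in 𝓝[<] 1, 0 < r ∧ r < 1 := Ioo_mem_nhdsLT zero_lt_one
  induction α using List.reverseRecOn with
  | nil =>
    rw [hx.1]
    refine tendsto_const_nhds.congr' ?_
    filter_upwards [hev] with r hr
    rw [stateAt_nil hT hr.1.le hr.2]
  | append_singleton α i ih =>
    rw [hx.2]
    have h1 : Tendsto (fun r : ℝ => (r : ℂ)) (𝓝[<] 1) (𝓝 1) := by
      have := (Complex.continuous_ofReal.tendsto 1).mono_left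
        (nhdsWithin_le_nhds (s := Set.Iio 1))
      simpa using this
    have h2 : Continuous fun z : H => (adjoint T z + defectFrom T (f α)) i :=
      (PiLp.continuous_apply 2 (fun _ : Fin n => H) i).comp
        ((adjoint T).continuous.add continuous_const)
    have h3 := h1.smul ((h2.tendsto (x α)).comp ih)
    rw [one_smul] at h3
    refine h3.congr' ?_
    filter_upwards [hev] with r hr
    rw [stateAt_append hT hr.1.le hr.2]
    rfl

/-- Both sides are limits of the same coefficient of `charFnAt T hT r f`. From here on the recursion
replaces the resolvent and the strong limit. -/
theorem charFn_apply {T : Copies n H →L[ℂ] H} (hT : ‖T‖ ≤ 1) {f : Fock n (defectSpace T)}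
    {x : List (Fin n) → H} (hx : IsStateSeq T f x) (α : List (Fin n)) :
    charFn T hT f α = -restrictDefect T hT (f α) + defectTo (adjoint T) (x α) := by
  have h1 := ((lp.evalCLM ℂ (fun _ : List (Fin n) => defectSpace (adjoint T)) 2 α).continuous.tendsto
    _).comp (charFn_tendsto T hT f)
  have h2 := (((defectTo (adjoint T)).continuous.tendsto _).comp
    (stateAt_tendsto hT hx α)).const_add (-restrictDefect T hT (f α))
  exact tendsto_nhds_unique h1 h2

end Transfer

/-! ### Unitary colligations -/

section Colligation

variable {H K : Type*} [NormedAddCommGroup H] [InnerProductSpace ℂ H] [CompleteSpace H]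
  [NormedAddCommGroup K] [InnerProductSpace ℂ K] [CompleteSpace K]

theorem norm_sq_defectTo {T : H →L[ℂ] K} (hT : ‖T‖ ≤ 1) (x : H) :
    ‖defectTo T x‖ ^ 2 = ‖x‖ ^ 2 - ‖T x‖ ^ 2 :=
  norm_sq_defectOp hT x

/-- Since `D_T` is self-adjoint, `defectFrom T` and `defectTo T` are adjoint to each other. -/
theorem inner_defectFrom (T : H →L[ℂ] K) (u : defectSpace T) (x : H) :
    inner ℂ (defectFrom T u) x = inner ℂ u (defectTo T x) :=
  ((ContinuousLinearMap.nonneg_iff_isPositive _).1 (defectOp_nonneg T)).isSymmetric (u : H) x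

theorem inner_defectTo (T : H →L[ℂ] K) (u : defectSpace T) (x : H) :
    inner ℂ (defectTo T x) u = inner ℂ x (defectFrom T u) :=
  ((ContinuousLinearMap.nonneg_iff_isPositive _).1 (defectOp_nonneg T)).isSymmetric x (u : H)

theorem denseRange_defectTo (T : H →L[ℂ] K) : DenseRange (defectTo T) := by
  rintro ⟨u, hu⟩
  rw [closure_subtype]
  have h : ((↑) '' Set.range (defectTo T) : Set H) =
      (LinearMap.range (defectOp T).toLinearMap : Set H) := by
    ext z
    constructor
    · rintro ⟨_, ⟨x, rfl⟩, rfl⟩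
      exact ⟨x, rfl⟩
    · rintro ⟨x, rfl⟩
      exact ⟨defectTo T x, ⟨x, rfl⟩, rfl⟩
  rw [h]
  exact hu

/-- A vector of `𝒟_T` killed by `D_T` is orthogonal to the range of `D_T`, which is dense in `𝒟_T`.
This allows identities in a defect space to be checked after applying the defect operator. -/
theorem defectFrom_injective (T : H →L[ℂ] K) : Function.Injective (defectFrom T) := by
  refine (injective_iff_map_eq_zero _).2 fun u hu => ?_
  refine Dense.eq_zero_of_inner_left (𝕜 := ℂ) (denseRange_defectTo T) ?_
  rintro _ ⟨x, rfl⟩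
  rw [← inner_defectFrom, hu, inner_zero_left]

/-- The colligation `(S, G; C, D) : H ⊕ E → K ⊕ E'` is unitary. -/
structure IsUnitaryColligation {H K E E' : Type*} [NormedAddCommGroup H] [InnerProductSpace ℂ H]
    [NormedAddCommGroup K] [InnerProductSpace ℂ K] [NormedAddCommGroup E] [InnerProductSpace ℂ E]
    [NormedAddCommGroup E'] [InnerProductSpace ℂ E'] (S : H →L[ℂ] K) (G : E →L[ℂ] K)
    (C : H →L[ℂ] E') (D : E →L[ℂ] E') : Prop where
  norm_sq : ∀ h e, ‖S h + G e‖ ^ 2 + ‖D e + C h‖ ^ 2 = ‖h‖ ^ 2 + ‖e‖ ^ 2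
  surj : ∀ k e', ∃ h e, S h + G e = k ∧ D e + C h = e'

/-- The colligation of a contraction `T` is onto. -/
theorem colligation_surj {T : H →L[ℂ] K} (hT : ‖T‖ ≤ 1) (k : H) (y : defectSpace (adjoint T)) :
    ∃ (h : K) (u : defectSpace T), adjoint T h + defectFrom T u = k ∧
      -restrictDefect T hT u + defectTo (adjoint T) h = y := by
  have hm : adjoint T y ∈ defectSpace T := by
    have := mapsTo_defectSpace (norm_adjoint_le hT) y
    rwa [adjoint_adjoint] at this
  -- The preimage is the adjoint matrix `(T, D_{T*}; D_T, -T*)` applied to `(k, y)`.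
  refine ⟨T k + defectFrom (adjoint T) y, defectTo T k - ⟨_, hm⟩, ?_, ?_⟩
  · have e1 := congrArg (fun S : H →L[ℂ] H => S k) (defectOp_sq hT)
    have e2 := defect_intertwine (norm_adjoint_le hT) (y : K)
    rw [adjoint_adjoint] at e2
    simp only [mul_apply_eq_comp, sub_apply, one_apply_eq_self,
      ContinuousLinearMap.comp_apply] at e1
    change adjoint T (T k + defectOp (adjoint T) y) + defectOp T (defectOp T k - adjoint T y) = k
    rw [map_add, map_sub, e1, e2]
    abel
  · have e1 := congrArg (fun S : K →L[ℂ] K => S y) (defectOp_sq (norm_adjoint_le hT))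
    have e2 := defect_intertwine hT k
    simp only [mul_apply_eq_comp, sub_apply, one_apply_eq_self, adjoint_adjoint,
      ContinuousLinearMap.comp_apply] at e1
    apply Subtype.ext
    change -T (defectOp T k - adjoint T y) +
      defectOp (adjoint T) (T k + defectOp (adjoint T) y) = y
    rw [map_add, map_sub, e1, e2]
    abel

/-- The colligation `(T*, D_T; D_{T*}, -T)` of a contraction `T` is unitary. -/
theorem isUnitaryColligation_defect {T : H →L[ℂ] K} (hT : ‖T‖ ≤ 1) :
    IsUnitaryColligation (adjoint T) (defectFrom T) (defectTo (adjoint T)) (-restrictDefect T hT) :=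
  ⟨fun h u => colligation_norm hT h u, colligation_surj hT⟩

variable {E E' : Type*} [NormedAddCommGroup E] [InnerProductSpace ℂ E] [CompleteSpace E]
  [NormedAddCommGroup E'] [InnerProductSpace ℂ E'] [CompleteSpace E']

/-- If `S` has dense range and `‖S x‖ = ‖D_T x‖`, then `S x ↦ D_T x` extends to a unitary
operator onto `𝒟_T`. -/
theorem exists_unitary_defectSpace (T : H →L[ℂ] K) (S : H →L[ℂ] E) (hS : DenseRange S)
    (h : ∀ x, ‖defectTo T x‖ = ‖S x‖) :
    ∃ W : E ≃ₗᵢ[ℂ] defectSpace T, ∀ x, W (S x) = defectTo T x :=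
  ⟨(LinearEquiv.refl ℂ H).extendOfIsometry S.toLinearMap (defectTo T).toLinearMap hS
    (denseRange_defectTo T) h, fun x => LinearEquiv.extendOfIsometry_eq _ _ _ hS
      (denseRange_defectTo T) h x⟩

theorem denseRange_of_adjoint_injective (S : H →L[ℂ] E)
    (h : ∀ e, adjoint S e = 0 → e = 0) : DenseRange S := by
  have h1 : (LinearMap.range S.toLinearMap)ᗮ = ⊥ := by
    rw [ContinuousLinearMap.orthogonal_range]
    exact (Submodule.eq_bot_iff _).2 fun e he => h e he
  have h2 := (Submodule.topologicalClosure_eq_top_iff).2 h1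
  have h3 := (Submodule.dense_iff_topologicalClosure_eq_top).2 h2
  exact h3

/-- A unitary colligation `(S, G; C, D)` with `D` purely contractive has the form
`(T*, D_T; D_{T*}, -T)`, up to unitary operators on its input and output spaces. -/
theorem exists_unitary_of_colligation (T : K →L[ℂ] H) (G : E →L[ℂ] K) (C : H →L[ℂ] E')
    (D : E →L[ℂ] E')
    (hU : IsUnitaryColligation (adjoint T) G C D)
    (hD : ∀ e, e ≠ 0 → ‖D e‖ < ‖e‖) :
    ∃ (hT : ‖T‖ ≤ 1) (W : E ≃ₗᵢ[ℂ] defectSpace T) (Ws : E' ≃ₗᵢ[ℂ] defectSpace (adjoint T)),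
      (∀ e, defectFrom T (W e) = G e) ∧ (∀ h, Ws (C h) = defectTo (adjoint T) h) ∧
      ∀ e, Ws (D e) = -restrictDefect T hT (W e) := by
  have hiso := hU.norm_sq
  -- The colligation is packaged as a linear isometry so that its norm identity polarizes to `hin`.
  let U : DSum H E →ₗᵢ[ℂ] DSum K E' :=
    { toLinearMap := (inlL K E' ∘L (adjoint T ∘L WithLp.fstL 2 ℂ H E + G ∘L WithLp.sndL 2 ℂ H E) +
        inrL K E' ∘L (D ∘L WithLp.sndL 2 ℂ H E + C ∘L WithLp.fstL 2 ℂ H E)).toLinearMap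
      norm_map' := fun z => by
        refine (pow_left_inj₀ (norm_nonneg _) (norm_nonneg _) two_ne_zero).1 ?_
        rw [WithLp.prod_norm_sq_eq_of_L2, WithLp.prod_norm_sq_eq_of_L2, ← hiso]
        simp [inlL_apply, inrL_apply] }
  have hin : ∀ h e h' e', inner ℂ (adjoint T h + G e) (adjoint T h' + G e') +
      inner ℂ (D e + C h) (D e' + C h') = inner ℂ h h' + inner ℂ e e' := by
    intro h e h' e'
    have := U.inner_map_map (WithLp.toLp 2 (h, e)) (WithLp.toLp 2 (h', e'))
    simpa [U, inlL_apply, inrL_apply, WithLp.prod_inner_apply, inner_add_left,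
      inner_add_right] using this
  -- `ha` and `hb` are the two rows of `U* U = I`.
  have ha : ∀ h e, T (adjoint T h + G e) + adjoint C (D e + C h) = h := by
    intro h e
    refine ext_inner_right ℂ fun h' => ?_
    have := hin h e h' 0
    simp only [map_zero, add_zero, zero_add, inner_zero_right] at this
    rw [inner_add_left, adjoint_inner_left, ← adjoint_inner_right]
    exact this
  have hb : ∀ h e, adjoint G (adjoint T h + G e) + adjoint D (D e + C h) = e := by
    intro h e
    refine ext_inner_right ℂ fun e' => ?_
    have := hin h e 0 e'
    simp only [map_zero, zero_add, add_zero, inner_zero_right] at this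
    rw [inner_add_left, adjoint_inner_left, adjoint_inner_left]
    exact this
  -- The adjoint of `U` is isometric as well: every `(k, e')` is some `U (h, e)`, and `U*` sends it
  -- back to `(h, e)`.
  have hco : ∀ k e', ‖T k + adjoint C e'‖ ^ 2 + ‖adjoint G k + adjoint D e'‖ ^ 2 =
      ‖k‖ ^ 2 + ‖e'‖ ^ 2 := by
    intro k e'
    obtain ⟨h, e, rfl, rfl⟩ := hU.surj k e'
    rw [ha, hb, hiso]
  have hT : ‖T‖ ≤ 1 := by
    refine T.opNorm_le_bound zero_le_one fun k => ?_
    have := hco k 0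
    simp only [map_zero, add_zero, norm_zero] at this
    rw [one_mul]
    exact (pow_le_pow_iff_left₀ (norm_nonneg _) (norm_nonneg _) two_ne_zero).1
      (by nlinarith [sq_nonneg ‖adjoint G k‖])
  -- If `G e = 0`, the norm identity gives `‖D e‖ = ‖e‖`, which purity allows only for `e = 0`.
  have hGd : DenseRange (adjoint G) := by
    refine denseRange_of_adjoint_injective _ fun e he => ?_
    rw [adjoint_adjoint] at he
    by_contra hne
    have h1 := hiso 0 e
    have h2 := hD e hne
    simp only [map_zero, add_zero, he, norm_zero] at h1
    nlinarith [norm_nonneg (D e), norm_nonneg e]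
  -- If `C* e' = 0`, the preimage `(h, e)` of `(0, e')` has `h = 0` by `ha`. Then `G e = 0` and `D e
  -- = e'`, so purity of `D` again gives `e = 0`; no strictness of `D*` has to be assumed.
  have hCd : DenseRange C := by
    refine denseRange_of_adjoint_injective _ fun e' he' => ?_
    obtain ⟨h, e, h1, h2⟩ := hU.surj 0 e'
    have h3 := ha h e
    rw [h1, h2, he', map_zero, add_zero] at h3
    subst h3
    simp only [map_zero, zero_add, add_zero] at h1 h2
    by_contra hne
    have hne' : e ≠ 0 := by
      rintro rfl
      exact hne (by rw [← h2, map_zero])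
    have h4 := hiso 0 e
    have h5 := hD e hne'
    simp only [map_zero, add_zero, h1, norm_zero] at h4
    nlinarith [norm_nonneg (D e), norm_nonneg e]
  obtain ⟨W, hW⟩ := exists_unitary_defectSpace T (adjoint G) hGd fun k => by
    refine (pow_left_inj₀ (norm_nonneg _) (norm_nonneg _) two_ne_zero).1 ?_
    have := hco k 0
    simp only [map_zero, add_zero, norm_zero] at this
    rw [norm_sq_defectTo hT]
    linarith
  obtain ⟨Ws, hWs⟩ := exists_unitary_defectSpace (adjoint T) C hCd fun h => by
    refine (pow_left_inj₀ (norm_nonneg _) (norm_nonneg _) two_ne_zero).1 ?_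
    have := hiso h 0
    simp only [map_zero, add_zero, zero_add, norm_zero] at this
    rw [norm_sq_defectTo (norm_adjoint_le hT)]
    linarith
  -- This is the adjoint of the relation `W G* = D_T`.
  have hWG : ∀ e, defectFrom T (W e) = G e := fun e => by
    refine ext_inner_right ℂ fun k => ?_
    rw [inner_defectFrom, ← hW, W.inner_map_map, adjoint_inner_right]
  refine ⟨hT, W, Ws, hWG, hWs, fun e => ?_⟩
  -- After applying `D_{T*}`, the left side becomes `C* D e`, which is `-T G e` by the orthogonality
  -- of the columns of `U`. Then `G = D_T W` and `T D_T = D_{T*} T` finish.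
  apply defectFrom_injective
  refine ext_inner_right ℂ fun h => ?_
  rw [inner_defectFrom, ← hWs, Ws.inner_map_map, ← adjoint_inner_left]
  have h1 := ha 0 e
  simp only [map_zero, zero_add, add_zero] at h1
  rw [eq_neg_of_add_eq_zero_right h1, map_neg, ← hWG]
  congr 2
  exact defect_intertwine hT _

end Colligation

/-! ### Row spaces of direct sums -/

section Copies

variable {n : ℕ} {H₁ H₂ : Type*}
  [NormedAddCommGroup H₁] [InnerProductSpace ℂ H₁]
  [NormedAddCommGroup H₂] [InnerProductSpace ℂ H₂]

/-- The identification `(⊕₁ⁿ H₁) ⊕ (⊕₁ⁿ H₂) → ⊕₁ⁿ (H₁ ⊕ H₂)`. -/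
def copiesMk (n : ℕ) (H₁ H₂ : Type*)
    [NormedAddCommGroup H₁] [InnerProductSpace ℂ H₁]
    [NormedAddCommGroup H₂] [InnerProductSpace ℂ H₂] :
    DSum (Copies n H₁) (Copies n H₂) →L[ℂ] Copies n (DSum H₁ H₂) :=
  ((PiLp.continuousLinearEquiv 2 ℂ (fun _ : Fin n => DSum H₁ H₂)).symm :
      (Fin n → DSum H₁ H₂) →L[ℂ] Copies n (DSum H₁ H₂)) ∘L
    ContinuousLinearMap.pi fun j =>
      inlL H₁ H₂ ∘L PiLp.proj 2 (fun _ : Fin n => H₁) j ∘L WithLp.fstL 2 ℂ _ _ +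
        inrL H₁ H₂ ∘L PiLp.proj 2 (fun _ : Fin n => H₂) j ∘L WithLp.sndL 2 ℂ _ _

theorem dsum_ext {E F : Type*} {a b : DSum E F} (h₁ : a.fst = b.fst) (h₂ : a.snd = b.snd) :
    a = b :=
  WithLp.ofLp_injective 2 (Prod.ext h₁ h₂)

theorem copies_ext {x y : Copies n (DSum H₁ H₂)} (h₁ : copiesFst n H₁ H₂ x = copiesFst n H₁ H₂ y)
    (h₂ : copiesSnd n H₁ H₂ x = copiesSnd n H₁ H₂ y) : x = y := by
  ext1 j
  exact dsum_ext (congrArg (fun v : Copies n H₁ => v j) h₁)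
    (congrArg (fun v : Copies n H₂ => v j) h₂)

theorem copiesFst_copiesMk (a : Copies n H₁) (b : Copies n H₂) :
    copiesFst n H₁ H₂ (copiesMk n H₁ H₂ (WithLp.toLp 2 (a, b))) = a := by
  ext j
  change (inlL H₁ H₂ (a j) + inrL H₁ H₂ (b j)).fst = _
  simp [inlL_apply, inrL_apply]

theorem copiesSnd_copiesMk (a : Copies n H₁) (b : Copies n H₂) :
    copiesSnd n H₁ H₂ (copiesMk n H₁ H₂ (WithLp.toLp 2 (a, b))) = b := by
  ext j
  change (inlL H₁ H₂ (a j) + inrL H₁ H₂ (b j)).snd = _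
  simp [inlL_apply, inrL_apply]

theorem inner_copies (x y : Copies n (DSum H₁ H₂)) :
    inner ℂ x y = inner ℂ (copiesFst n H₁ H₂ x) (copiesFst n H₁ H₂ y) +
      inner ℂ (copiesSnd n H₁ H₂ x) (copiesSnd n H₁ H₂ y) := by
  simp only [PiLp.inner_apply, WithLp.prod_inner_apply, Finset.sum_add_distrib]
  rfl

theorem norm_sq_copies (x : Copies n (DSum H₁ H₂)) :
    ‖x‖ ^ 2 = ‖copiesFst n H₁ H₂ x‖ ^ 2 + ‖copiesSnd n H₁ H₂ x‖ ^ 2 := by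
  have := congrArg RCLike.re (inner_copies x x)
  simpa only [map_add, inner_self_eq_norm_sq] using this

theorem norm_sq_toLp {E F : Type*} [NormedAddCommGroup E] [NormedAddCommGroup F] (x : E) (y : F) :
    ‖(WithLp.toLp 2 (x, y) : DSum E F)‖ ^ 2 = ‖x‖ ^ 2 + ‖y‖ ^ 2 :=
  WithLp.prod_norm_sq_eq_of_L2 _

theorem inner_upperTriangular (A : Copies n H₁ →L[ℂ] H₁) (X : Copies n H₂ →L[ℂ] H₁)
    (B : Copies n H₂ →L[ℂ] H₂) (h : DSum H₁ H₂) (k : Copies n (DSum H₁ H₂)) :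
    inner ℂ h (upperTriangular A X B k) = inner ℂ h.fst (A (copiesFst n H₁ H₂ k)) +
      inner ℂ h.fst (X (copiesSnd n H₁ H₂ k)) + inner ℂ h.snd (B (copiesSnd n H₁ H₂ k)) := by
  rw [WithLp.prod_inner_apply, ← inner_add_right]
  simp [upperTriangular, inlL_apply, inrL_apply]

/-- In adjoint form the corner `X` becomes a feed from the first state into the second, which is the
shape of the state operator of a cascade. -/
theorem adjoint_upperTriangular [CompleteSpace H₁] [CompleteSpace H₂]
    (A : Copies n H₁ →L[ℂ] H₁) (X : Copies n H₂ →L[ℂ] H₁)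
    (B : Copies n H₂ →L[ℂ] H₂) (h : DSum H₁ H₂) :
    adjoint (upperTriangular A X B) h =
      copiesMk n H₁ H₂ (WithLp.toLp 2 (adjoint A h.fst, adjoint B h.snd + adjoint X h.fst)) := by
  refine ext_inner_right ℂ fun k => ?_
  rw [adjoint_inner_left, inner_copies, copiesFst_copiesMk, copiesSnd_copiesMk,
    inner_upperTriangular, inner_add_left, adjoint_inner_left, adjoint_inner_left,
    adjoint_inner_left]
  ring

end Copies

/-! ### The cascade of two colligations -/

section Cascade

variable {n : ℕ} {H₁ H₂ E₁ E₁' E₂ E₂' F Fs : Type*}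
  [NormedAddCommGroup H₁] [InnerProductSpace ℂ H₁]
  [NormedAddCommGroup H₂] [InnerProductSpace ℂ H₂]
  [NormedAddCommGroup E₁] [InnerProductSpace ℂ E₁]
  [NormedAddCommGroup E₁'] [InnerProductSpace ℂ E₁']
  [NormedAddCommGroup E₂] [InnerProductSpace ℂ E₂]
  [NormedAddCommGroup E₂'] [InnerProductSpace ℂ E₂']
  [NormedAddCommGroup F] [InnerProductSpace ℂ F]
  [NormedAddCommGroup Fs] [InnerProductSpace ℂ Fs]

/-- The output `w ((C₁ x + D₁ e₁) ⊕ e₂)` of the first colligation of a cascade for the state `x`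
and the input `e = e₁ ⊕ e₂`, which is the input of the second one. -/
def cascadeLink (C₁ : H₁ →L[ℂ] E₁') (D₁ : E₁ →L[ℂ] E₁') (w : DSum E₁' F ≃ₗᵢ[ℂ] DSum E₂ Fs)
    (x : H₁) (e : DSum E₁ F) : DSum E₂ Fs :=
  w (WithLp.toLp 2 (D₁ e.fst + C₁ x, e.snd))

/-- The cascade of the colligations `(S₁, G₁; C₁, D₁)` and `(S₂, G₂; C₂, D₂)` through `w`. -/
theorem exists_cascade (S₁ : H₁ →L[ℂ] Copies n H₁) (G₁ : E₁ →L[ℂ] Copies n H₁)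
    (C₁ : H₁ →L[ℂ] E₁') (D₁ : E₁ →L[ℂ] E₁') (S₂ : H₂ →L[ℂ] Copies n H₂)
    (G₂ : E₂ →L[ℂ] Copies n H₂) (C₂ : H₂ →L[ℂ] E₂') (D₂ : E₂ →L[ℂ] E₂')
    (w : DSum E₁' F ≃ₗᵢ[ℂ] DSum E₂ Fs) :
    ∃ (S : DSum H₁ H₂ →L[ℂ] Copies n (DSum H₁ H₂)) (G : DSum E₁ F →L[ℂ] Copies n (DSum H₁ H₂))
      (C : DSum H₁ H₂ →L[ℂ] DSum E₂' Fs) (D : DSum E₁ F →L[ℂ] DSum E₂' Fs),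
      (∀ x y e, S (WithLp.toLp 2 (x, y)) + G e = copiesMk n H₁ H₂ (WithLp.toLp 2
          (S₁ x + G₁ e.fst, S₂ y + G₂ (cascadeLink C₁ D₁ w x e).fst))) ∧
      ∀ x y e, D e + C (WithLp.toLp 2 (x, y)) = WithLp.toLp 2
        (D₂ (cascadeLink C₁ D₁ w x e).fst + C₂ y, (cascadeLink C₁ D₁ w x e).snd) := by
  let wL : DSum E₁' F →L[ℂ] DSum E₂ Fs := w.toContinuousLinearEquiv
  -- By linearity the link vector is `Q (x, y) + P e`, a state part and an input part; `N` is the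
  -- second direct term `D₂` together with the bypass on `Fs`.
  let P : DSum E₁ F →L[ℂ] DSum E₂ Fs :=
    wL ∘L (inlL _ F ∘L D₁ ∘L WithLp.fstL 2 ℂ _ _ + inrL _ F ∘L WithLp.sndL 2 ℂ _ _)
  let Q : DSum H₁ H₂ →L[ℂ] DSum E₂ Fs := wL ∘L inlL _ F ∘L C₁ ∘L WithLp.fstL 2 ℂ _ _
  let N : DSum E₂ Fs →L[ℂ] DSum E₂' Fs :=
    inlL _ Fs ∘L D₂ ∘L WithLp.fstL 2 ℂ _ _ + inrL _ Fs ∘L WithLp.sndL 2 ℂ _ _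
  refine ⟨copiesMk n H₁ H₂ ∘L (inlL _ _ ∘L S₁ ∘L WithLp.fstL 2 ℂ _ _ +
      inrL _ _ ∘L (S₂ ∘L WithLp.sndL 2 ℂ _ _ + G₂ ∘L WithLp.fstL 2 ℂ _ _ ∘L Q)),
    copiesMk n H₁ H₂ ∘L (inlL _ _ ∘L G₁ ∘L WithLp.fstL 2 ℂ _ _ +
      inrL _ _ ∘L G₂ ∘L WithLp.fstL 2 ℂ _ _ ∘L P),
    N ∘L Q + inlL _ Fs ∘L C₂ ∘L WithLp.sndL 2 ℂ _ _, N ∘L P, fun x y e => ?_, fun x y e => ?_⟩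
  all_goals
    have hu : cascadeLink C₁ D₁ w x e = Q (WithLp.toLp 2 (x, y)) + P e := by
      change w _ = w _ + w _
      rw [← map_add]
      congr 1
      apply dsum_ext <;> simp [inlL_apply, inrL_apply, add_comm]
    rw [hu]
    generalize hq : Q (WithLp.toLp 2 (x, y)) = q
    generalize hp : P e = p
  · simp only [ContinuousLinearMap.comp_apply, add_apply, hq, hp]
    rw [← map_add]
    congr 1
    apply dsum_ext
    · simp [inlL_apply, inrL_apply]
    · simp [inlL_apply, inrL_apply, add_assoc]
  · simp only [ContinuousLinearMap.comp_apply, add_apply, hq, hp]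
    apply dsum_ext
    · simp [N, inlL_apply, inrL_apply, add_comm, add_left_comm]
    · simp [N, inlL_apply, inrL_apply, add_comm]

/-- A cascade of unitary colligations is unitary. -/
theorem isUnitaryColligation_cascade {S₁ : H₁ →L[ℂ] Copies n H₁} {G₁ : E₁ →L[ℂ] Copies n H₁}
    {C₁ : H₁ →L[ℂ] E₁'} {D₁ : E₁ →L[ℂ] E₁'} {S₂ : H₂ →L[ℂ] Copies n H₂}
    {G₂ : E₂ →L[ℂ] Copies n H₂} {C₂ : H₂ →L[ℂ] E₂'} {D₂ : E₂ →L[ℂ] E₂'}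
    (w : DSum E₁' F ≃ₗᵢ[ℂ] DSum E₂ Fs) (h₁ : IsUnitaryColligation S₁ G₁ C₁ D₁)
    (h₂ : IsUnitaryColligation S₂ G₂ C₂ D₂)
    {S : DSum H₁ H₂ →L[ℂ] Copies n (DSum H₁ H₂)} {G : DSum E₁ F →L[ℂ] Copies n (DSum H₁ H₂)}
    {C : DSum H₁ H₂ →L[ℂ] DSum E₂' Fs} {D : DSum E₁ F →L[ℂ] DSum E₂' Fs}
    (hSG : ∀ x y e, S (WithLp.toLp 2 (x, y)) + G e = copiesMk n H₁ H₂ (WithLp.toLp 2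
      (S₁ x + G₁ e.fst, S₂ y + G₂ (cascadeLink C₁ D₁ w x e).fst)))
    (hCD : ∀ x y e, D e + C (WithLp.toLp 2 (x, y)) = WithLp.toLp 2
      (D₂ (cascadeLink C₁ D₁ w x e).fst + C₂ y, (cascadeLink C₁ D₁ w x e).snd)) :
    IsUnitaryColligation S G C D := by
  constructor
  · rintro ⟨x, y⟩ e
    -- The two norm identities are added; the norm of the signal passed between the systems cancels
    -- because `w` preserves it.
    have e1 := h₁.norm_sq x e.fst
    have e2 := h₂.norm_sq y (cascadeLink C₁ D₁ w x e).fst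
    have e3 : ‖cascadeLink C₁ D₁ w x e‖ ^ 2 = ‖D₁ e.fst + C₁ x‖ ^ 2 + ‖e.snd‖ ^ 2 :=
      (congrArg (· ^ 2) (w.norm_map _)).trans (norm_sq_toLp _ _)
    rw [WithLp.prod_norm_sq_eq_of_L2] at e3
    rw [hSG, hCD, norm_sq_copies, copiesFst_copiesMk, copiesSnd_copiesMk, norm_sq_toLp,
      norm_sq_toLp, WithLp.prod_norm_sq_eq_of_L2 e]
    linarith
  · intro k e'
    -- The cascade is solved backwards: the second system, then `w`, then the first system.
    obtain ⟨b, u, e1, e2⟩ := h₂.surj (copiesSnd n H₁ H₂ k) e'.fst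
    obtain ⟨z, hz⟩ := w.surjective (WithLp.toLp 2 (u, e'.snd))
    obtain ⟨a, v, e3, e4⟩ := h₁.surj (copiesFst n H₁ H₂ k) z.fst
    have hu : cascadeLink C₁ D₁ w a (WithLp.toLp 2 (v, z.snd)) = WithLp.toLp 2 (u, e'.snd) := by
      rw [← hz]
      exact congrArg w (dsum_ext e4 rfl)
    refine ⟨WithLp.toLp 2 (a, b), WithLp.toLp 2 (v, z.snd), ?_, ?_⟩
    · rw [hSG, hu]
      exact copies_ext ((copiesFst_copiesMk _ _).trans e3) ((copiesSnd_copiesMk _ _).trans e1)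
    · rw [hCD, hu]
      exact dsum_ext e2 rfl

theorem diagId_apply {E E' : Type u} {G : Type v}
    [NormedAddCommGroup E] [InnerProductSpace ℂ E] [NormedAddCommGroup E'] [InnerProductSpace ℂ E']
    [NormedAddCommGroup G] [InnerProductSpace ℂ G] (M : Fock n E →L[ℂ] Fock n E')
    (f : Fock n (DSum E G)) (α : List (Fin n)) :
    diagId G M f α =
      (WithLp.toLp 2 (M (ampl n (WithLp.fstL 2 ℂ E G) f) α, (f α).snd) : DSum E' G) := by
  change inlL E' G (M (ampl n (WithLp.fstL 2 ℂ E G) f) α) + inrL E' G (f α).snd = _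
  apply dsum_ext <;> simp [inlL_apply, inrL_apply]

end Cascade

/-! ### The product of characteristic functions as a transfer function -/

section CharFnProduct

variable {n : ℕ} {H₁ : Type u} {H₂ : Type v} {F Fs : Type*}
  [NormedAddCommGroup H₁] [InnerProductSpace ℂ H₁] [CompleteSpace H₁]
  [NormedAddCommGroup H₂] [InnerProductSpace ℂ H₂] [CompleteSpace H₂]
  [NormedAddCommGroup F] [InnerProductSpace ℂ F]
  [NormedAddCommGroup Fs] [InnerProductSpace ℂ Fs]

/-- The product of characteristic functions is the transfer function of the cascade. -/
theorem exists_cascade_stateSeq {A : Copies n H₁ →L[ℂ] H₁} (hA : ‖A‖ ≤ 1)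
    {B : Copies n H₂ →L[ℂ] H₂} (hB : ‖B‖ ≤ 1)
    (w : DSum (defectSpace (adjoint A)) F ≃ₗᵢ[ℂ] DSum (defectSpace B) Fs)
    {S : DSum H₁ H₂ →L[ℂ] Copies n (DSum H₁ H₂)}
    {G : DSum (defectSpace A) F →L[ℂ] Copies n (DSum H₁ H₂)}
    {C : DSum H₁ H₂ →L[ℂ] DSum (defectSpace (adjoint B)) Fs}
    {D : DSum (defectSpace A) F →L[ℂ] DSum (defectSpace (adjoint B)) Fs}
    (hSG : ∀ x y e, S (WithLp.toLp 2 (x, y)) + G e = copiesMk n H₁ H₂ (WithLp.toLp 2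
      (adjoint A x + defectFrom A e.fst, adjoint B y + defectFrom B
        (cascadeLink (defectTo (adjoint A)) (-restrictDefect A hA) w x e).fst)))
    (hCD : ∀ x y e, D e + C (WithLp.toLp 2 (x, y)) = WithLp.toLp 2
      ((-restrictDefect B hB)
        (cascadeLink (defectTo (adjoint A)) (-restrictDefect A hA) w x e).fst +
          defectTo (adjoint B) y,
        (cascadeLink (defectTo (adjoint A)) (-restrictDefect A hA) w x e).snd))
    (f : Fock n (DSum (defectSpace A) F)) :
    ∃ x : List (Fin n) → DSum H₁ H₂, x [] = 0 ∧
      (∀ α i, x (α ++ [i]) = (S (x α) + G (f α)) i) ∧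
      ∀ α, (diagId Fs (charFn B hB) ∘L
        ampl n (w.toContinuousLinearEquiv :
          DSum (defectSpace (adjoint A)) F →L[ℂ] DSum (defectSpace B) Fs) ∘L
        diagId F (charFn A hA)) f α = D (f α) + C (x α) := by
  let L := cascadeLink (defectTo (adjoint A)) (-restrictDefect A hA) w
  obtain ⟨a, ha⟩ := exists_isStateSeq A (ampl n (WithLp.fstL 2 ℂ _ _) f)
  -- `g` is the signal entering the second system; by `hg` it depends at each word only on the first
  -- state and the input at that word.
  let g : Fock n (DSum (defectSpace B) Fs) :=
    ampl n (w.toContinuousLinearEquiv :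
      DSum (defectSpace (adjoint A)) F →L[ℂ] DSum (defectSpace B) Fs) (diagId F (charFn A hA) f)
  have hg : ∀ α, g α = L (a α) (f α) := by
    intro α
    change w (diagId F (charFn A hA) f α) = _
    rw [diagId_apply, charFn_apply hA ha]
    rfl
  obtain ⟨b, hb⟩ := exists_isStateSeq B (ampl n (WithLp.fstL 2 ℂ _ _) g)
  refine ⟨fun α => WithLp.toLp 2 (a α, b α), ?_, fun α i => ?_, fun α => ?_⟩
  · change WithLp.toLp 2 (a [], b []) = 0
    rw [ha.1, hb.1]
    rfl
  · rw [hSG]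
    change _ = (copiesMk n H₁ H₂ (WithLp.toLp 2 (_, adjoint B (b α) +
      defectFrom B (L (a α) (f α)).fst))) i
    rw [← hg]
    apply dsum_ext
    · exact (ha.2 α i).trans
        (congrArg (fun v : Copies n H₁ => v i) (copiesFst_copiesMk _ _)).symm
    · exact (hb.2 α i).trans
        (congrArg (fun v : Copies n H₂ => v i) (copiesSnd_copiesMk _ _)).symm
  · rw [hCD]
    change diagId Fs (charFn B hB) g α = WithLp.toLp 2 (-restrictDefect B hB
      (L (a α) (f α)).fst + _, (L (a α) (f α)).snd)
    rw [diagId_apply, charFn_apply hB hb, ← hg]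
    rfl

end CharFnProduct

/-! ### From a unitary colligation to a characteristic function -/

section Coincidence

variable {n : ℕ} {H E E' : Type*}
  [NormedAddCommGroup H] [InnerProductSpace ℂ H] [CompleteSpace H]
  [NormedAddCommGroup E] [InnerProductSpace ℂ E] [CompleteSpace E]
  [NormedAddCommGroup E'] [InnerProductSpace ℂ E'] [CompleteSpace E']

/-- A purely contractive operator that is the transfer function of a unitary colligation with state
operator `T*` coincides with the characteristic function of `T`. -/
theorem coincides_charFn_of_colligation {T : Copies n H →L[ℂ] H} {G : E →L[ℂ] Copies n H}
    {C : H →L[ℂ] E'} {D : E →L[ℂ] E'} {Θ : Fock n E →L[ℂ] Fock n E'}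
    (hU : IsUnitaryColligation (adjoint T) G C D)
    (hΘ : ∀ f, ∃ x : List (Fin n) → H, x [] = 0 ∧
      (∀ α i, x (α ++ [i]) = (adjoint T (x α) + G (f α)) i) ∧ ∀ α, Θ f α = D (f α) + C (x α))
    (hpure : IsPurelyContractive Θ) : ∃ hT : ‖T‖ ≤ 1, Coincides Θ (charFn T hT) := by
  -- The initial state is zero, so `D e` is the vacuum coefficient of `Θ (e_∅ ⊗ e)`.
  have hD : ∀ e, e ≠ 0 → ‖D e‖ < ‖e‖ := by
    intro e he
    obtain ⟨x, h0, -, hx⟩ := hΘ (elem [] e)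
    have h := hpure.2 e he
    rw [hx, h0, map_zero, add_zero] at h
    simpa [elem] using h
  obtain ⟨hT, W, Ws, hG, hC, hWD⟩ := exists_unitary_of_colligation T G C D hU hD
  refine ⟨hT, W, Ws, ?_⟩
  ext1 f
  ext1
  funext α
  obtain ⟨x, h0, hs, hx⟩ := hΘ f
  -- Because `G = D_T W`, the same states solve the canonical system of `T` with input `W f`.
  have hst : IsStateSeq T (ampl n (W.toContinuousLinearEquiv : E →L[ℂ] defectSpace T) f) x := by
    refine ⟨h0, fun α i => ?_⟩
    rw [hs, ← hG]
    rfl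
  rw [ContinuousLinearMap.comp_apply, ContinuousLinearMap.comp_apply, charFn_apply hT hst]
  change Ws (Θ f α) = _
  rw [hx, map_add, hC, hWD]
  rfl

end Coincidence

/-! ### The adjoint of the off-diagonal corner -/

section Corner

variable {E E' G G' : Type*}
  [NormedAddCommGroup E] [InnerProductSpace ℂ E] [NormedAddCommGroup E'] [InnerProductSpace ℂ E']
  [NormedAddCommGroup G] [InnerProductSpace ℂ G] [NormedAddCommGroup G'] [InnerProductSpace ℂ G']

theorem inner_adjointCorner (w : DSum E G ≃ₗᵢ[ℂ] DSum E' G') (x : E) (y : E') :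
    inner ℂ x (adjointCorner w y) =
      inner ℂ (w (WithLp.toLp 2 (x, 0) : DSum E G)).fst y := by
  have h := w.inner_map_eq_flip (WithLp.toLp 2 (x, 0)) (WithLp.toLp 2 (y, 0))
  simp only [WithLp.prod_inner_apply] at h
  simpa [inlL_apply, adjointCorner] using h.symm

variable {n : ℕ} {H₁ H₂ : Type*}
  [NormedAddCommGroup H₁] [InnerProductSpace ℂ H₁] [CompleteSpace H₁]
  [NormedAddCommGroup H₂] [InnerProductSpace ℂ H₂] [CompleteSpace H₂]

/-- Taking adjoints factor by factor turns `D_{A*} (P w*|) D_B` into `D_B (P w|) D_{A*}`, the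
coupling of the two states in the cascade. -/
theorem adjoint_defect_corner (A : Copies n H₁ →L[ℂ] H₁) (B : Copies n H₂ →L[ℂ] H₂)
    (w : DSum (defectSpace (adjoint A)) G ≃ₗᵢ[ℂ] DSum (defectSpace B) G') (h : H₁) :
    adjoint (defectFrom (adjoint A) ∘L adjointCorner w ∘L defectTo B) h =
      defectFrom B (w (WithLp.toLp 2 (defectTo (adjoint A) h, 0))).fst := by
  refine ext_inner_right ℂ fun k => ?_
  rw [adjoint_inner_left, ContinuousLinearMap.comp_apply, ContinuousLinearMap.comp_apply,
    ← inner_defectTo, inner_adjointCorner, inner_defectFrom]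

end Corner

end RowContraction

end

/-! ### The factorization theorem -/

theorem mainTheorem2 {n : ℕ} {H₁ H₂ F Fs : Type*}
    [NormedAddCommGroup H₁] [InnerProductSpace ℂ H₁] [CompleteSpace H₁]
    [NormedAddCommGroup H₂] [InnerProductSpace ℂ H₂] [CompleteSpace H₂]
    [NormedAddCommGroup F] [InnerProductSpace ℂ F] [CompleteSpace F]
    [NormedAddCommGroup Fs] [InnerProductSpace ℂ Fs] [CompleteSpace Fs]
    (A : Copies n H₁ →L[ℂ] H₁) (hA : ‖A‖ ≤ 1) (B : Copies n H₂ →L[ℂ] H₂) (hB : ‖B‖ ≤ 1)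
    (w : DSum (defectSpace (adjoint A)) F ≃ₗᵢ[ℂ] DSum (defectSpace B) Fs)
    (Θ : Fock n (DSum (defectSpace A) F) →L[ℂ] Fock n (DSum (defectSpace (adjoint B)) Fs))
    (hΘ : Θ = diagId Fs (charFn B hB) ∘L
      ampl n (w.toContinuousLinearEquiv :
        DSum (defectSpace (adjoint A)) F →L[ℂ] DSum (defectSpace B) Fs) ∘L
      diagId F (charFn A hA))
    (hmulti : IsMultiAnalytic Θ) (hpure : IsPurelyContractive Θ)
    (T : Copies n (DSum H₁ H₂) →L[ℂ] DSum H₁ H₂)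
    (hT : T = upperTriangular A (defectFrom (adjoint A) ∘L adjointCorner w ∘L defectTo B) B) :
    ∃ hTc : ‖T‖ ≤ 1, Coincides Θ (charFn T hTc) := by
  obtain ⟨S, G, C, D, hSG, hCD⟩ := exists_cascade (adjoint A) (defectFrom A)
    (defectTo (adjoint A)) (-restrictDefect A hA) (adjoint B) (defectFrom B)
    (defectTo (adjoint B)) (-restrictDefect B hB) w
  -- Zero input isolates the state operator in `hSG`; what remains of the link is `w (D_{A*} x ⊕
  -- 0)`.
  have hS : S = adjoint T := by
    ext1 z
    have h := hSG z.fst z.snd 0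
    rw [map_zero, add_zero] at h
    rw [hT, adjoint_upperTriangular, adjoint_defect_corner]
    refine h.trans ?_
    simp only [cascadeLink, WithLp.zero_fst, WithLp.zero_snd, map_zero, zero_add, add_zero]
  subst hS
  have hstate : ∀ f, ∃ x : List (Fin n) → DSum H₁ H₂, x [] = 0 ∧
      (∀ α i, x (α ++ [i]) = (adjoint T (x α) + G (f α)) i) ∧
      ∀ α, Θ f α = D (f α) + C (x α) := by
    rw [hΘ]
    exact exists_cascade_stateSeq hA hB w hSG hCD
  exact coincides_charFn_of_colligation (isUnitaryColligation_cascade w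
    (isUnitaryColligation_defect hA) (isUnitaryColligation_defect hB) hSG hCD) hstate hpure
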